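/- Let $l\ge 3$ and $r>l$ be integers and let $\epsilon\in[0,1]$. For $n\ge 1$ with $r\mid nl$ put $m=nl/r$ and let $\Gamma$ be uniformly distributed on the set of all (simple, labelled) bipartite graphs with $n$ variable nodes $V=\{1,\dots,n\}$, each of degree $l$, and $m$ check nodes $C=\{1,\dots,m\}$, each of degree $r$. Write $\partial a\subseteq V$ for the set of neighbours of a check node $a$. The binary erasure channel BEC($\epsilon$) has inputs $\sigma\in\{-1,1\}$, outputs $s\in\{-1,0,1\}$ and transition probabilities $q(0\mid\sigma)=\epsilon$, $q(\sigma\mid\sigma)=1-\epsilon$, $q(-\sigma\mid\sigma)=0$. Given an output $\underline s\in\{-1,0,1\}^n$, let $$\mu_\Gamma(\underline\sigma\mid\underline s)=\frac1{Z(\Gamma,\underline s)}\prod_{a\in C}\frac12\Bigl(1+\prod_{i\in\partial a}\sigma_i\Bigr)\prod_{i\in V}q(s_i\mid\sigma_i),\qquad \underline\sigma\in\{-1,1\}^n,$$ be the posterior distribution for a codeword with uniform prior, where $Z(\Gamma,\underline s)$ is the normalization, and let $\langle\sigma_i\rangle_{\mid\underline s}$ be the mean of $\sigma_i$ under it. The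 bit-error probability of the bit-sampling decoder (which draws the $i$-th bit from its posterior marginal) when the codeword $(1,\dots,1)$ is transmitted is $$P_\Gamma^{\text{bit-sampling}}=\frac12\Bigl(1-\mathbb E_{\underline s}\Bigl[\frac1n\sum_{i=1}^n\langle\sigma_i\rangle_{\mid\underline s}\Bigr]\Bigr),$$ where $\underline s$ has i.i.d. entries with law $q(\cdot\mid 1)$. For $\rho\in[0,1]$ let $$D(\rho)=\Bigl\{(x_0,x_c,\underline y)\in[0,1]^{2+\lfloor r/2\rfloor}:\ \sum_{t=1}^{\lfloor r/2\rfloor}y_t\le 1,\ \sum_{t=1}^{\lfloor r/2\rfloor}\frac{2t}{r}y_t=(1-\rho)x_0+\rho x_c\Bigr\},$$ and, with $h_2(p)=-(1-p)\ln(1-p)-p\ln p$, $0\ln 0=0$ and $Y=\sum_{t=1}^{\lfloor r/2\rfloor}y_t$, let $$f(x_0,x_c,\underline y,\rho)=-l\,h_2\bigl((1-\rho)x_0+\rho x_c\bigr)+(1-\rho)h_2(x_0)+\rho h_2(x_c)-\frac lr(1-Y)\ln(1-Y)-\frac lr\sum_{t=1}^{\lfloor r/2\rfloor}y_t\ln y_t+\frac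 lr\sum_{t=1}^{\lfloor r/2\rfloor}y_t\ln\binom r{2t}.$$ **Theorem.** If $(0,0,\underline 0)$ is the only maximizer of $f(0,x_c,\underline y,\epsilon)$ over the points $(0,x_c,\underline y)\in D(\epsilon)$ with $x_0=0$, then $$\lim_{n\to\infty}\mathbb E_{\Gamma}\bigl[P_\Gamma^{\text{bit-sampling}}\bigr]=0,$$ where $n$ runs through the positive integers with $r\mid nl$. -/

import Mathlib

open Filter Topology
open scoped BigOperators

namespace LDPC

/-- A bipartite graph with variable nodes `Fin n` and check nodes `Fin m`,
given by its set of edges `E ⊆ V × C`. -/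
abbrev BipGraph (n m : ℕ) : Type := Finset (Fin n × Fin m)

/-- The neighbourhood `∂i` of a variable node. -/
def varNbrs {n m : ℕ} (Γ : BipGraph n m) (i : Fin n) : Finset (Fin m) :=
  Finset.univ.filter fun a => (i, a) ∈ Γ

/-- The neighbourhood `∂a` of a check node. -/
def checkNbrs {n m : ℕ} (Γ : BipGraph n m) (a : Fin m) : Finset (Fin n) :=
  Finset.univ.filter fun i => (i, a) ∈ Γ

/-- Every variable node has degree `l` and every check node has degree `r`. -/
def IsBiregular (l r : ℕ) {n m : ℕ} (Γ : BipGraph n m) : Prop :=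
  (∀ i, (varNbrs Γ i).card = l) ∧ (∀ a, (checkNbrs Γ a).card = r)

open Classical in
/-- The ensemble of all `(l, r)` regular bipartite graphs with `n` variable nodes and
`m` check nodes. -/
noncomputable def ensemble (l r n m : ℕ) : Finset (BipGraph n m) :=
  Finset.univ.filter fun Γ => IsBiregular l r Γ

/-- Transition probability `q(s ∣ σ)` of the binary erasure channel: the input `σ` is `±1`
(an element of `ℤˣ`), the output `s` is `-1`, `0` or `1` (`0` is an erasure). -/
noncomputable def becProb (ε : ℝ) (s : SignType) (σ : ℤˣ) : ℝ :=
  if s = 0 then ε else if (s : ℤ) = (σ : ℤ) then 1 - ε else 0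

/-- The spin `σ = ±1` as a real number. -/
def spin (σ : ℤˣ) : ℝ := ((σ : ℤ) : ℝ)

/-- The unnormalized posterior weight
`∏_a ½ (1 + ∏_{i ∈ ∂a} σ_i) · ∏_i q(s_i ∣ σ_i)`. -/
noncomputable def posteriorWeight (ε : ℝ) {n m : ℕ} (Γ : BipGraph n m)
    (s : Fin n → SignType) (σ : Fin n → ℤˣ) : ℝ :=
  (∏ a : Fin m, (1 / 2 : ℝ) * (1 + ∏ i ∈ checkNbrs Γ a, spin (σ i))) *
    ∏ i : Fin n, becProb ε (s i) (σ i)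

/-- The partition function `Z(Γ, s)`. -/
noncomputable def partitionFn (ε : ℝ) {n m : ℕ} (Γ : BipGraph n m)
    (s : Fin n → SignType) : ℝ :=
  ∑ σ : Fin n → ℤˣ, posteriorWeight ε Γ s σ

/-- The posterior probability `μ_Γ(σ ∣ s)`. The partition function is positive for every output
`s` that has positive probability when the all-one codeword is sent. -/
noncomputable def posterior (ε : ℝ) {n m : ℕ} (Γ : BipGraph n m)
    (s : Fin n → SignType) (σ : Fin n → ℤˣ) : ℝ :=
  posteriorWeight ε Γ s σ / partitionFn ε Γ s

/-- The posterior average `⟨σ_i⟩_{∣ s}`. -/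
noncomputable def posteriorMean (ε : ℝ) {n m : ℕ} (Γ : BipGraph n m)
    (s : Fin n → SignType) (i : Fin n) : ℝ :=
  ∑ σ : Fin n → ℤˣ, posterior ε Γ s σ * spin (σ i)

/-- Expectation over the channel output when the all-one codeword is sent:
the `s_i` are i.i.d. with law `q(· ∣ +1)`. -/
noncomputable def channelExpect (ε : ℝ) {n : ℕ} (F : (Fin n → SignType) → ℝ) : ℝ :=
  ∑ s : Fin n → SignType, (∏ i : Fin n, becProb ε (s i) 1) * F s

/-- The bit-error probability of the bit-sampling decoder,
`½ (1 - 𝔼_s [ (1/n) ∑_i ⟨σ_i⟩_{∣ s} ])`. -/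
noncomputable def bitSamplingError (ε : ℝ) {n m : ℕ} (Γ : BipGraph n m) : ℝ :=
  (1 / 2 : ℝ) *
    (1 - channelExpect ε fun s => (1 / (n : ℝ)) * ∑ i : Fin n, posteriorMean ε Γ s i)

/-- The average of the bit-error probability over the ensemble of `(l, r)` regular bipartite
graphs with `n` variable nodes and `m` check nodes, under the uniform distribution. -/
noncomputable def expectedBitSamplingError (l r : ℕ) (ε : ℝ) (n m : ℕ) : ℝ :=
  (∑ Γ ∈ ensemble l r n m, bitSamplingError ε Γ) / ((ensemble l r n m).card : ℝ)

/-- Triples `(x₀, x_c, y)` with `y = (y_1, …, y_{⌊r/2⌋})`;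
the entry of `y` with index `t : Fin (r / 2)` is `y_{t+1}`. -/
abbrev LoopType (r : ℕ) : Type := ℝ × ℝ × (Fin (r / 2) → ℝ)

/-- The domain `D(ρ)`: all entries lie in `[0, 1]`, `∑_t y_t ≤ 1` and
`∑_t (2t/r) y_t = (1 - ρ) x₀ + ρ x_c`. -/
def domain (r : ℕ) (ρ : ℝ) : Set (LoopType r) :=
  {p | p.1 ∈ Set.Icc (0 : ℝ) 1 ∧ p.2.1 ∈ Set.Icc (0 : ℝ) 1 ∧
    (∀ t, p.2.2 t ∈ Set.Icc (0 : ℝ) 1) ∧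
    ∑ t, p.2.2 t ≤ 1 ∧
    ∑ t : Fin (r / 2), (2 * ((t : ℝ) + 1) / (r : ℝ)) * p.2.2 t = (1 - ρ) * p.1 + ρ * p.2.1}

/-- The function `f(x₀, x_c, y, ρ)`. Here `Real.binEntropy` is the binary entropy in nats, and
`0 * ln 0 = 0`. -/
noncomputable def f (l r : ℕ) (p : LoopType r) (ρ : ℝ) : ℝ :=
  - (l : ℝ) * Real.binEntropy ((1 - ρ) * p.1 + ρ * p.2.1)
    + (1 - ρ) * Real.binEntropy p.1 + ρ * Real.binEntropy p.2.1
    - (l : ℝ) / r * ((1 - ∑ t, p.2.2 t) * Real.log (1 - ∑ t, p.2.2 t))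
    - (l : ℝ) / r * ∑ t, p.2.2 t * Real.log (p.2.2 t)
    + (l : ℝ) / r * ∑ t : Fin (r / 2),
        p.2.2 t * Real.log ((r.choose (2 * ((t : ℕ) + 1)) : ℕ) : ℝ)

/-- The part `{(0, x_c, y) ∈ D(ρ)}` of the domain where `x₀ = 0`. -/
def domainZero (r : ℕ) (ρ : ℝ) : Set (LoopType r) :=
  {p | p ∈ domain r ρ ∧ p.1 = 0}

/-- The set of maximizers of `f(0, x_c, y, ρ)` over `(0, x_c, y) ∈ D(ρ)`. -/
def argmaxZero (l r : ℕ) (ρ : ℝ) : Set (LoopType r) :=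
  {p | p ∈ domainZero r ρ ∧ ∀ p' ∈ domainZero r ρ, f l r p' ρ ≤ f l r p ρ}

end LDPC

/-!
# Vanishing bit error of regular LDPC codes on the erasure channel

The posterior given an erasure pattern is supported on codewords (relative to the all-one
codeword) whose support lies in the erased set `E`, and the error probability of the bit-sampling
decoder is the mean relative weight of a posterior sample (`half_one_sub_mean`). Hence, for every
`δ > 0`, it is at most `δ` plus the number of codewords of weight at least `δ n` supported on `E`
(`outputError_le`). By Chebyshev's inequality `|E| / n` is close to `ε`, so it suffices that the
expected number of such codewords tends to `0` for every fixed `E` with `|E| / n` near `ε`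
(`expectedBitSamplingError_le`).

This first moment is computed in the configuration model, where half-edges at variable nodes are
matched to half-edges at check nodes by a uniform bijection. There the half-edges of a set `W` go
to a uniform set of `|W| l` check half-edges, and `W` supports a codeword when that set meets every
check in evenly many half-edges. Counting such sets by the method of types (`card_type_le`), and
bounding binomial coefficients by entropies, bounds the first moment by `exp (n f)` up to a
polynomial factor, `f` being evaluated at points of weight at least `δ` (`mul_f_eq`). As the origin
is the only maximizer, compactness and continuity bound `f` away from `0` at those points,
uniformly for `ρ` near `ε` (`exists_f_le_neg`).

The passage from configurations to simple graphs needs only a polynomial lower bound on the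
probability that a configuration is simple (`card_equiv_le_mul_card_badPairs_eq_empty`): the
expected number of pairs of parallel edges is bounded, and boundedly many transpositions remove
them all, so the configurations with few such pairs outnumber the simple ones at most polynomially.
-/

namespace LDPC

set_option linter.unusedSectionVars false

/-! ### Simple configurations -/

section Configurations

variable {U T V C : Type*} [Fintype U] [Fintype T] [DecidableEq U] [DecidableEq T]
  [DecidableEq V] [DecidableEq C]

/-- The ordered pairs of distinct half-edges that the configuration `e` turns into parallel
edges. The maps `v` and `c` send a half-edge to the variable node or check node it belongs to. -/
def badPairs (v : U → V) (c : T → C) (e : U ≃ T) : Finset (U × U) :=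
  Finset.univ.filter fun p => p.1 ≠ p.2 ∧ v p.1 = v p.2 ∧ c (e p.1) = c (e p.2)

lemma mem_badPairs {v : U → V} {c : T → C} {e : U ≃ T} {p : U × U} :
    p ∈ badPairs v c e ↔ p.1 ≠ p.2 ∧ v p.1 = v p.2 ∧ c (e p.1) = c (e p.2) := by
  simp [badPairs]

/-- The number of configurations that put `p` and `q` at a common check does not depend on the
pair of distinct half-edges, so it is at most the average over `q ≠ p`. -/
lemma card_sameCheck_le {c : T → C} {r : ℕ}
    (hc : ∀ t, (Finset.univ.filter fun t' => c t' = c t).card ≤ r) {p q : U} (hpq : p ≠ q) :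
    (Fintype.card U - 1) * (Finset.univ.filter fun e : U ≃ T => c (e p) = c (e q)).card
      ≤ r * Fintype.card (U ≃ T) := by
  have hsym : ∀ q' ∈ Finset.univ.erase p,
      (Finset.univ.filter fun e : U ≃ T => c (e p) = c (e q')).card
        = (Finset.univ.filter fun e : U ≃ T => c (e p) = c (e q)).card := by
    intro q' hq'
    have hq' : q' ≠ p := Finset.ne_of_mem_erase hq'
    refine Finset.card_equiv ((Equiv.swap q q').equivCongr (Equiv.refl T)) fun e => ?_
    simp [Equiv.equivCongr, Equiv.swap_apply_of_ne_of_ne hpq hq'.symm]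
  have h1 : (Fintype.card U - 1) * (Finset.univ.filter fun e : U ≃ T => c (e p) = c (e q)).card
      = ∑ q' ∈ Finset.univ.erase p,
        (Finset.univ.filter fun e : U ≃ T => c (e p) = c (e q')).card := by
    rw [Finset.sum_congr rfl hsym, Finset.sum_const, Finset.card_erase_of_mem (Finset.mem_univ _),
      Finset.card_univ, smul_eq_mul]
  rw [h1]
  simp_rw [Finset.card_filter]
  rw [Finset.sum_comm]
  calc _ ≤ ∑ e : U ≃ T, r := by
        refine Finset.sum_le_sum fun e _ => ?_
        rw [← Finset.card_filter]
        refine le_trans (Finset.card_le_card_of_injOn e ?_ e.injective.injOn) (hc (e p))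
        intro x hx
        simp only [Finset.coe_filter, Finset.mem_erase, Finset.mem_univ, and_true,
          Set.mem_ofPred_eq, true_and] at hx ⊢
        exact hx.2.symm
    _ = _ := by simp [mul_comm]

/-- The mean number of bad pairs of a configuration is bounded. -/
lemma sum_card_badPairs_le {v : U → V} {c : T → C} {l r : ℕ}
    (hv : ∀ u, (Finset.univ.filter fun u' => v u' = v u).card ≤ l)
    (hc : ∀ t, (Finset.univ.filter fun t' => c t' = c t).card ≤ r)
    (hN : 2 ≤ Fintype.card U) :
    ∑ e : U ≃ T, (badPairs v c e).card ≤ 2 * (l * r) * Fintype.card (U ≃ T) := by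
  have h1 : ∑ e : U ≃ T, (badPairs v c e).card
      = ∑ p : U × U, if p.1 ≠ p.2 ∧ v p.1 = v p.2 then
          (Finset.univ.filter fun e : U ≃ T => c (e p.1) = c (e p.2)).card else 0 := by
    simp_rw [badPairs, Finset.card_filter]
    rw [Finset.sum_comm]
    refine Finset.sum_congr rfl fun p _ => ?_
    split_ifs with h
    · simp [h.1, h.2]
    · refine Finset.sum_eq_zero fun e _ => if_neg fun h' => h ⟨h'.1, h'.2.1⟩
  have h2 : (Fintype.card U - 1) * ∑ e : U ≃ T, (badPairs v c e).card
      ≤ Fintype.card U * l * (r * Fintype.card (U ≃ T)) := by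
    rw [h1, Finset.mul_sum]
    calc _ ≤ ∑ p : U × U, if v p.2 = v p.1 then r * Fintype.card (U ≃ T) else 0 := by
          refine Finset.sum_le_sum fun p _ => ?_
          by_cases h : p.1 ≠ p.2 ∧ v p.1 = v p.2
          · rw [if_pos h, if_pos h.2.symm]
            exact card_sameCheck_le hc h.1
          · rw [if_neg h]
            simp
      _ ≤ ∑ u : U, l * (r * Fintype.card (U ≃ T)) := by
          rw [Fintype.sum_prod_type]
          refine Finset.sum_le_sum fun u _ => ?_
          rw [← Finset.sum_filter, Finset.sum_const, smul_eq_mul]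
          exact Nat.mul_le_mul_right _ (hv u)
      _ = _ := by simp [mul_assoc]
  obtain ⟨k, hk⟩ : ∃ k, Fintype.card U = k + 2 := ⟨_, (Nat.sub_add_cancel hN).symm⟩
  rw [hk] at h2
  have h3 : (k + 1) * ∑ e : U ≃ T, (badPairs v c e).card
      ≤ (k + 1) * (2 * (l * r) * Fintype.card (U ≃ T)) := by
    refine h2.trans ?_
    nlinarith [Nat.zero_le (k * (l * (r * Fintype.card (U ≃ T))))]
  exact Nat.le_of_mul_le_mul_left h3 (Nat.succ_pos k)

/-- Markov's inequality for the number of bad pairs. -/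
lemma card_le_two_mul_card_badPairs_le {v : U → V} {c : T → C} {l r : ℕ} (hlr : 0 < l * r)
    (hv : ∀ u, (Finset.univ.filter fun u' => v u' = v u).card ≤ l)
    (hc : ∀ t, (Finset.univ.filter fun t' => c t' = c t).card ≤ r)
    (hN : 2 ≤ Fintype.card U) :
    Fintype.card (U ≃ T) ≤
      2 * (Finset.univ.filter fun e : U ≃ T => (badPairs v c e).card ≤ 4 * (l * r)).card := by
  have h1 := sum_card_badPairs_le hv hc hN
  have h2 : (Finset.univ.filter fun e : U ≃ T => ¬ (badPairs v c e).card ≤ 4 * (l * r)).card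
      * (4 * (l * r)) ≤ ∑ e : U ≃ T, (badPairs v c e).card := by
    rw [← smul_eq_mul]
    refine (Finset.card_nsmul_le_sum _ _ _ fun e he => ?_).trans
      (Finset.sum_le_sum_of_subset (Finset.filter_subset _ _))
    exact (not_le.mp (Finset.mem_filter.mp he).2).le
  have h3 := Finset.card_filter_add_card_filter_not (s := (Finset.univ : Finset (U ≃ T)))
    (fun e : U ≃ T => (badPairs v c e).card ≤ 4 * (l * r))
  rw [Finset.card_univ] at h3
  have h4 : 2 * (l * r) * (2 *
      (Finset.univ.filter fun e : U ≃ T => ¬ (badPairs v c e).card ≤ 4 * (l * r)).card)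
      ≤ 2 * (l * r) * Fintype.card (U ≃ T) := by
    refine le_trans (le_of_eq ?_) (h2.trans h1)
    ring
  have h5 := Nat.le_of_mul_le_mul_left h4 (by omega)
  omega

/-- Some transposition of half-edges destroys a bad pair without creating new ones: exchange `p`
with a half-edge `u` whose check is not adjacent to the variable node of `p` and whose variable
node is not adjacent to the check of `p`. -/
lemma exists_swap_card_badPairs_lt {v : U → V} {c : T → C} {l r : ℕ}
    (hv : ∀ u, (Finset.univ.filter fun u' => v u' = v u).card ≤ l)
    (hc : ∀ t, (Finset.univ.filter fun t' => c t' = c t).card ≤ r)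
    (hN : 2 * (l * r) < Fintype.card U) {e : U ≃ T} (he : (badPairs v c e).Nonempty) :
    ∃ p u : U, (badPairs v c ((Equiv.swap p u).trans e)).card < (badPairs v c e).card := by
  obtain ⟨⟨p, q⟩, hpq⟩ := he
  -- the half-edges at the checks adjacent to `v p`
  let A : Finset U := (Finset.univ.filter fun x => v x = v p).biUnion fun x =>
    Finset.univ.filter fun y => c (e y) = c (e x)
  -- the half-edges at the variable nodes adjacent to `c (e p)`
  let B : Finset U := (Finset.univ.filter fun x => c (e x) = c (e p)).biUnion fun x =>
    Finset.univ.filter fun y => v y = v x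
  have hce : ∀ x, (Finset.univ.filter fun y => c (e y) = c (e x)).card ≤ r := fun x => by
    refine le_trans (Finset.card_le_card_of_injOn e ?_ e.injective.injOn) (hc (e x))
    intro y hy
    simpa using hy
  have hA : A.card ≤ l * r := by
    refine (Finset.card_biUnion_le_card_mul _ _ r fun x _ => hce x).trans ?_
    exact Nat.mul_le_mul_right _ (hv p)
  have hB : B.card ≤ r * l := by
    refine (Finset.card_biUnion_le_card_mul _ _ l fun x _ => hv x).trans ?_
    exact Nat.mul_le_mul_right _ (hce p)
  have hAB : (A ∪ B).card < (Finset.univ : Finset U).card := by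
    have := Finset.card_union_le A B
    rw [Finset.card_univ]
    nlinarith
  obtain ⟨u, -, hu⟩ := Finset.exists_mem_notMem_of_card_lt_card hAB
  have huA : ∀ x, v x = v p → c (e u) ≠ c (e x) := by
    intro x hx h
    exact hu (Finset.mem_union_left _ (Finset.mem_biUnion.mpr ⟨x, by simp [hx], by simp [h]⟩))
  have huB : ∀ x, c (e x) = c (e p) → v u ≠ v x := by
    intro x hx h
    exact hu (Finset.mem_union_right _ (Finset.mem_biUnion.mpr ⟨x, by simp [hx], by simp [h]⟩))
  have hvu : v u ≠ v p := huB p rfl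
  refine ⟨p, u, Finset.card_lt_card (Finset.ssubset_iff_subset_ne.mpr ?_)⟩
  -- neither `p` nor `u` lies in a bad pair of the new configuration
  have key : ∀ x y, x ≠ y → v x = v y →
      c (e (Equiv.swap p u x)) = c (e (Equiv.swap p u y)) → x ≠ p ∧ x ≠ u := by
    intro x y hxy hvxy hcxy
    constructor
    · rintro rfl
      have hyu : y ≠ u := by rintro rfl; exact hvu hvxy.symm
      rw [Equiv.swap_apply_left, Equiv.swap_apply_of_ne_of_ne hxy.symm hyu] at hcxy
      exact huA y hvxy.symm hcxy
    · rintro rfl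
      have hyp : y ≠ p := by rintro rfl; exact hvu hvxy
      rw [Equiv.swap_apply_right, Equiv.swap_apply_of_ne_of_ne hyp hxy.symm] at hcxy
      exact huB y hcxy.symm hvxy
  have hsub : ∀ z ∈ badPairs v c ((Equiv.swap p u).trans e), z ∈ badPairs v c e ∧ z.1 ≠ p := by
    rintro ⟨x, y⟩ hz
    rw [mem_badPairs] at hz
    obtain ⟨h1, h2, h3⟩ := hz
    simp only [Equiv.trans_apply] at h1 h2 h3
    obtain ⟨hx, hx'⟩ := key x y h1 h2 h3
    obtain ⟨hy, hy'⟩ := key y x h1.symm h2.symm h3.symm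
    rw [Equiv.swap_apply_of_ne_of_ne hx hx', Equiv.swap_apply_of_ne_of_ne hy hy'] at h3
    exact ⟨mem_badPairs.mpr ⟨h1, h2, h3⟩, hx⟩
  refine ⟨fun z hz => (hsub z hz).1, fun h => ?_⟩
  rw [← h] at hpq
  exact (hsub _ hpq).2 rfl

/-- Every configuration with at most `b` bad pairs arises from a simple one by at most `b`
transpositions, each chosen among `N ^ 2`. -/
lemma card_badPairs_le_mul_pow {v : U → V} {c : T → C} {l r : ℕ}
    (hv : ∀ u, (Finset.univ.filter fun u' => v u' = v u).card ≤ l)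
    (hc : ∀ t, (Finset.univ.filter fun t' => c t' = c t).card ≤ r)
    (hN : 2 * (l * r) < Fintype.card U) (b : ℕ) :
    (Finset.univ.filter fun e : U ≃ T => (badPairs v c e).card ≤ b).card ≤
      (Fintype.card U ^ 2) ^ b *
        (Finset.univ.filter fun e : U ≃ T => (badPairs v c e).card ≤ 0).card := by
  induction b with
  | zero => simp
  | succ b ih =>
    have hsub : (Finset.univ.filter fun e : U ≃ T => (badPairs v c e).card ≤ b + 1) ⊆
        ((Finset.univ : Finset (U × U)) ×ˢ
          (Finset.univ.filter fun e : U ≃ T => (badPairs v c e).card ≤ b)).image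
          fun x => (Equiv.swap x.1.1 x.1.2).trans x.2 := by
      intro e he
      have he := (Finset.mem_filter.mp he).2
      rw [Finset.mem_image]
      by_cases hb : (badPairs v c e).Nonempty
      · obtain ⟨p, u, hpu⟩ := exists_swap_card_badPairs_lt hv hc hN hb
        refine ⟨((p, u), (Equiv.swap p u).trans e), ?_, ?_⟩
        · simp only [Finset.mem_product, Finset.mem_univ, Finset.mem_filter, true_and]
          omega
        · ext x
          simp
      · obtain ⟨p⟩ : Nonempty U := Fintype.card_pos_iff.mp (by omega)
        refine ⟨((p, p), e), ?_, ?_⟩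
        · simp [Finset.not_nonempty_iff_eq_empty.mp hb]
        · ext x
          simp
    calc _ ≤ _ := Finset.card_le_card hsub
      _ ≤ _ := Finset.card_image_le
      _ = Fintype.card U ^ 2 *
          (Finset.univ.filter fun e : U ≃ T => (badPairs v c e).card ≤ b).card := by
        rw [Finset.card_product, Finset.card_univ, Fintype.card_prod, sq]
      _ ≤ _ := by
        rw [pow_succ' (Fintype.card U ^ 2) b, mul_assoc]
        exact Nat.mul_le_mul_left _ ih

/-- A polynomially small proportion, at least, of the configurations has no parallel edges. -/
theorem card_equiv_le_mul_card_badPairs_eq_empty {v : U → V} {c : T → C} {l r : ℕ}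
    (hlr : 0 < l * r)
    (hv : ∀ u, (Finset.univ.filter fun u' => v u' = v u).card ≤ l)
    (hc : ∀ t, (Finset.univ.filter fun t' => c t' = c t).card ≤ r)
    (hN : 2 * (l * r) < Fintype.card U) :
    Fintype.card (U ≃ T) ≤ 2 * Fintype.card U ^ (8 * (l * r)) *
      (Finset.univ.filter fun e : U ≃ T => badPairs v c e = ∅).card := by
  refine (card_le_two_mul_card_badPairs_le hlr hv hc (by omega)).trans ?_
  have := card_badPairs_le_mul_pow hv hc hN (T := T) (4 * (l * r))
  rw [← pow_mul] at this
  simp only [Nat.le_zero, Finset.card_eq_zero] at this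
  rw [mul_assoc]
  refine Nat.mul_le_mul_left _ (this.trans (le_of_eq ?_))
  ring_nf

end Configurations

/-! ### From configurations to graphs -/

section Matchings

variable {U X V : Type*} [Fintype U] [Fintype X] [DecidableEq U] [DecidableEq X] [DecidableEq V]

/-- Bijections over a base `V` form a torsor under the permutations over `V`. -/
lemma card_equiv_over (v : U → V) (w : X → V)
    (h : ∀ y, Fintype.card {u // v u = y} = Fintype.card {x // w x = y}) :
    Fintype.card {α : U ≃ X // ∀ u, w (α u) = v u} =
      Fintype.card {τ : Equiv.Perm U // ∀ u, v (τ u) = v u} := by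
  let α₀ : U ≃ X := (Equiv.sigmaFiberEquiv v).symm.trans
    ((Equiv.sigmaCongrRight fun y => Fintype.equivOfCardEq (h y)).trans (Equiv.sigmaFiberEquiv w))
  have h₀ : ∀ u, w (α₀ u) = v u := fun u =>
    (Fintype.equivOfCardEq (h (v u)) ⟨u, rfl⟩).2
  have h₁ : ∀ x, v (α₀.symm x) = w x := fun x => by rw [← h₀, Equiv.apply_symm_apply]
  refine Fintype.card_congr
    { toFun := fun α => ⟨α.1.trans α₀.symm, fun u => by simp [h₁, α.2]⟩
      invFun := fun τ => ⟨τ.1.trans α₀, fun u => by simp [h₀, τ.2]⟩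
      left_inv := fun α => by ext; simp
      right_inv := fun τ => by ext; simp }

end Matchings

section Images

variable {U T : Type*} [Fintype U] [Fintype T] [DecidableEq U] [DecidableEq T]

/-- The image of a fixed set under a uniform bijection is uniform among the sets of its size. -/
lemma card_equiv_map_mul_choose (P : Finset U) (Q : Finset T → Prop) [DecidablePred Q] :
    (Finset.univ.filter fun e : U ≃ T => Q (P.map e.toEmbedding)).card *
        (Fintype.card T).choose P.card =
      Fintype.card (U ≃ T) *
        ((Finset.powersetCard P.card (Finset.univ : Finset T)).filter Q).card := by
  let k : Finset T → ℕ := fun S =>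
    (Finset.univ.filter fun e : U ≃ T => P.map e.toEmbedding = S).card
  have hk : ∀ S S' : Finset T, S.card = S'.card → k S = k S' := by
    intro S S' hS
    obtain ⟨σ, hσ⟩ := Equiv.Perm.exists_map_finset_eq S S' hS
    refine Finset.card_equiv ((Equiv.refl U).equivCongr σ) fun e => ?_
    have h1 : P.map ((Equiv.refl U).equivCongr σ e).toEmbedding
        = (P.map e.toEmbedding).map σ.toEmbedding := by
      ext x
      simp only [Finset.mem_map_equiv]
      rfl
    simp only [Finset.mem_filter, Finset.mem_univ, true_and]
    rw [h1, ← hσ, Finset.map_inj]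
  have hmaps : ∀ e : U ≃ T, P.map e.toEmbedding ∈ Finset.powersetCard P.card Finset.univ := by
    intro e
    simp [Finset.mem_powersetCard]
  obtain ⟨κ, hκ⟩ : ∃ κ, ∀ S ∈ Finset.powersetCard P.card (Finset.univ : Finset T), k S = κ := by
    by_cases hne : (Finset.powersetCard P.card (Finset.univ : Finset T)).Nonempty
    · obtain ⟨S₀, hS₀⟩ := hne
      refine ⟨k S₀, fun S hS => hk S S₀ ?_⟩
      rw [(Finset.mem_powersetCard.mp hS).2, (Finset.mem_powersetCard.mp hS₀).2]
    · exact ⟨0, fun S hS => absurd ⟨S, hS⟩ hne⟩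
  have hall : Fintype.card (U ≃ T) = (Fintype.card T).choose P.card * κ := by
    rw [← Finset.card_univ, Finset.card_eq_sum_card_fiberwise (fun e _ => hmaps e),
      Finset.sum_congr rfl hκ, Finset.sum_const, Finset.card_powersetCard, Finset.card_univ,
      smul_eq_mul]
  have hQ : (Finset.univ.filter fun e : U ≃ T => Q (P.map e.toEmbedding)).card =
      ((Finset.powersetCard P.card (Finset.univ : Finset T)).filter Q).card * κ := by
    rw [Finset.card_eq_sum_card_fiberwise (f := fun e : U ≃ T => P.map e.toEmbedding)
      (t := (Finset.powersetCard P.card (Finset.univ : Finset T)).filter Q)]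
    · rw [← smul_eq_mul, ← Finset.sum_const]
      refine Finset.sum_congr rfl fun S hS => ?_
      obtain ⟨hS, hQS⟩ := Finset.mem_filter.mp hS
      rw [← hκ S hS, Finset.filter_filter]
      congr 1
      ext e
      simp only [Finset.mem_filter, Finset.mem_univ, true_and, and_iff_right_iff_imp]
      rintro rfl
      exact hQS
    · intro e he
      simp only [Finset.coe_filter, Finset.mem_univ, true_and, Set.mem_ofPred_eq] at he ⊢
      exact ⟨hmaps e, he⟩
  rw [hall, hQ]
  ring

end Images

/-- The bipartite (multi)graph of a configuration, parallel edges being identified. -/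
def graphOf {n m l r : ℕ} (e : Fin n × Fin l ≃ Fin m × Fin r) : BipGraph n m :=
  Finset.univ.image fun u => (u.1, (e u).1)

/-- A configuration without parallel edges. -/
abbrev IsSimple {n m l r : ℕ} (e : Fin n × Fin l ≃ Fin m × Fin r) : Prop :=
  badPairs Prod.fst Prod.fst e = ∅

section Graphs

variable {n m l r : ℕ} {e : Fin n × Fin l ≃ Fin m × Fin r}

lemma isSimple_iff : IsSimple e ↔ Function.Injective fun u => (u.1, (e u).1) := by
  rw [IsSimple, Finset.eq_empty_iff_forall_notMem]
  constructor
  · intro h x y hxy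
    by_contra hne
    exact h (x, y) (mem_badPairs.mpr ⟨hne, (Prod.ext_iff.mp hxy).1, (Prod.ext_iff.mp hxy).2⟩)
  · rintro h ⟨x, y⟩ hxy
    obtain ⟨h1, h2, h3⟩ := mem_badPairs.mp hxy
    exact h1 (h (Prod.ext h2 h3))

lemma mem_graphOf {i : Fin n} {a : Fin m} :
    (i, a) ∈ graphOf e ↔ ∃ j, (e (i, j)).1 = a := by
  simp only [graphOf, Finset.mem_image, Finset.mem_univ, true_and, Prod.exists, Prod.mk.injEq]
  constructor
  · rintro ⟨_, j, rfl, h⟩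
    exact ⟨j, h⟩
  · rintro ⟨j, h⟩
    exact ⟨i, j, rfl, h⟩

lemma mem_graphOf' {i : Fin n} {a : Fin m} :
    (i, a) ∈ graphOf e ↔ ∃ k, (e.symm (a, k)).1 = i := by
  rw [mem_graphOf]
  constructor
  · rintro ⟨j, rfl⟩
    exact ⟨(e (i, j)).2, by simp⟩
  · rintro ⟨k, rfl⟩
    exact ⟨(e.symm (a, k)).2, by simp⟩

lemma IsSimple.injective_var (he : IsSimple e) (i : Fin n) :
    Function.Injective fun j => (e (i, j)).1 := by
  intro j j' h
  have := isSimple_iff.mp he (a₁ := (i, j)) (a₂ := (i, j')) (Prod.ext rfl h)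
  exact (Prod.ext_iff.mp this).2

lemma IsSimple.injective_check (he : IsSimple e) (a : Fin m) :
    Function.Injective fun k => (e.symm (a, k)).1 := by
  intro k k' h
  have := isSimple_iff.mp he (a₁ := e.symm (a, k)) (a₂ := e.symm (a, k')) (Prod.ext h (by simp))
  exact (Prod.ext_iff.mp (e.symm.injective this)).2

lemma card_checkNbrs_inter_graphOf (he : IsSimple e) (a : Fin m) (W : Finset (Fin n)) :
    (checkNbrs (graphOf e) a ∩ W).card =
      (Finset.univ.filter fun k => (e.symm (a, k)).1 ∈ W).card := by
  have h : checkNbrs (graphOf e) a ∩ W =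
      (Finset.univ.filter fun k => (e.symm (a, k)).1 ∈ W).image fun k => (e.symm (a, k)).1 := by
    ext i
    simp only [checkNbrs, mem_graphOf', Finset.mem_inter, Finset.mem_filter, Finset.mem_univ,
      true_and, Finset.mem_image]
    constructor
    · rintro ⟨⟨k, rfl⟩, hW⟩
      exact ⟨k, hW, rfl⟩
    · rintro ⟨k, hW, rfl⟩
      exact ⟨⟨k, rfl⟩, hW⟩
  rw [h, Finset.card_image_of_injective _ (he.injective_check a)]

lemma graphOf_mem_ensemble (he : IsSimple e) : graphOf e ∈ ensemble l r n m := by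
  simp only [ensemble, Finset.mem_filter, Finset.mem_univ, true_and]
  refine ⟨fun i => ?_, fun a => ?_⟩
  · have h : varNbrs (graphOf e) i = Finset.univ.image fun j => (e (i, j)).1 := by
      ext a
      simp [varNbrs, mem_graphOf]
    rw [h, Finset.card_image_of_injective _ (he.injective_var i), Finset.card_univ,
      Fintype.card_fin]
  · have := card_checkNbrs_inter_graphOf he a Finset.univ
    simpa using this

lemma card_fst_fiber {n l : ℕ} (i : Fin n) :
    Fintype.card {u : Fin n × Fin l // u.1 = i} = l := by
  let φ : {u : Fin n × Fin l // u.1 = i} ≃ Fin l :=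
    { toFun := fun u => u.1.2
      invFun := fun j => ⟨(i, j), rfl⟩
      left_inv := by rintro ⟨⟨i', j⟩, rfl⟩; rfl
      right_inv := fun j => rfl }
  exact (Fintype.card_congr φ).trans (Fintype.card_fin l)

/-- A simple configuration with graph `Γ` amounts to an enumeration of the edges of `Γ` at each
variable node together with one at each check node. -/
lemma card_isSimple_graphOf_eq {Γ : BipGraph n m} (hΓ : Γ ∈ ensemble l r n m) :
    (Finset.univ.filter fun e : Fin n × Fin l ≃ Fin m × Fin r =>
        IsSimple e ∧ graphOf e = Γ).card =
      Fintype.card {τ : Equiv.Perm (Fin n × Fin l) // ∀ u, (τ u).1 = u.1} *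
        Fintype.card {τ : Equiv.Perm (Fin m × Fin r) // ∀ u, (τ u).1 = u.1} := by
  simp only [ensemble, Finset.mem_filter, Finset.mem_univ, true_and] at hΓ
  have hV : ∀ i, Fintype.card {u : Fin n × Fin l // u.1 = i} =
      Fintype.card {x : Γ // x.1.1 = i} := by
    intro i
    rw [card_fst_fiber, ← hΓ.1 i, ← Fintype.card_coe]
    exact Fintype.card_congr
      { toFun := fun a => ⟨⟨(i, a.1), (Finset.mem_filter.mp a.2).2⟩, rfl⟩
        invFun := fun x => ⟨x.1.1.2, by
          obtain ⟨⟨⟨i', a⟩, hx⟩, rfl⟩ := x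
          simpa [varNbrs] using hx⟩
        left_inv := fun a => rfl
        right_inv := by rintro ⟨⟨⟨i', a⟩, hx⟩, rfl⟩; rfl }
  have hC : ∀ a, Fintype.card {u : Fin m × Fin r // u.1 = a} =
      Fintype.card {x : Γ // x.1.2 = a} := by
    intro a
    rw [card_fst_fiber, ← hΓ.2 a, ← Fintype.card_coe]
    exact Fintype.card_congr
      { toFun := fun i => ⟨⟨(i.1, a), (Finset.mem_filter.mp i.2).2⟩, rfl⟩
        invFun := fun x => ⟨x.1.1.1, by
          obtain ⟨⟨⟨i', a⟩, hx⟩, rfl⟩ := x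
          simpa [checkNbrs] using hx⟩
        left_inv := fun a => rfl
        right_inv := by rintro ⟨⟨⟨i', a⟩, hx⟩, rfl⟩; rfl }
  rw [← card_equiv_over (fun u : Fin n × Fin l => u.1) (fun x : Γ => x.1.1) hV,
    ← card_equiv_over (fun u : Fin m × Fin r => u.1) (fun x : Γ => x.1.2) hC,
    ← Fintype.card_prod, ← Finset.card_univ]
  symm
  refine Finset.card_bij (fun p _ => p.1.1.trans p.2.1.symm) ?_ ?_ ?_
  · rintro ⟨⟨α, hα⟩, ⟨β, hβ⟩⟩ -
    have hval : ∀ u, (u.1, (β.symm (α u)).1) = (α u).1 := fun u => by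
      refine Prod.ext (hα u).symm ?_
      have := hβ (β.symm (α u))
      rw [Equiv.apply_symm_apply] at this
      exact this.symm
    simp only [Finset.mem_filter, Finset.mem_univ, true_and]
    refine ⟨isSimple_iff.mpr ?_, ?_⟩
    · intro x y hxy
      simp only [Equiv.trans_apply, hval] at hxy
      exact α.injective (Subtype.ext hxy)
    · ext x
      simp only [graphOf, Equiv.trans_apply, hval, Finset.mem_image, Finset.mem_univ, true_and]
      exact ⟨by rintro ⟨u, rfl⟩; exact (α u).2, fun hx => ⟨α.symm ⟨x, hx⟩, by simp⟩⟩
  · rintro ⟨⟨α, hα⟩, ⟨β, hβ⟩⟩ - ⟨⟨α', hα'⟩, ⟨β', hβ'⟩⟩ - h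
    simp only at h
    have hval : ∀ u, (β.symm (α u)) = (β'.symm (α' u)) := fun u => Equiv.congr_fun h u
    have hα2 : α = α' := by
      ext1 u
      refine Subtype.ext (Prod.ext ((hα u).trans (hα' u).symm) ?_)
      have h1 := hβ (β.symm (α u))
      have h2 := hβ' (β'.symm (α' u))
      rw [Equiv.apply_symm_apply] at h1 h2
      rw [h1, h2, hval]
    subst hα2
    have hβ2 : β.symm = β'.symm := by
      ext1 x
      have := hval (α.symm x)
      rwa [Equiv.apply_symm_apply] at this
    have hβ3 : β = β' := by rw [← β.symm_symm, hβ2, β'.symm_symm]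
    subst hβ3
    rfl
  · intro e he
    simp only [Finset.mem_filter, Finset.mem_univ, true_and] at he
    obtain ⟨he, rfl⟩ := he
    let α : Fin n × Fin l ≃ graphOf e := Equiv.ofBijective
      (fun u => ⟨(u.1, (e u).1), Finset.mem_image_of_mem _ (Finset.mem_univ u)⟩)
      ⟨fun x y hxy => isSimple_iff.mp he (congrArg Subtype.val hxy), by
        rintro ⟨x, hx⟩
        obtain ⟨u, -, rfl⟩ := Finset.mem_image.mp hx
        exact ⟨u, rfl⟩⟩
    refine ⟨⟨⟨α, fun u => rfl⟩, ⟨e.symm.trans α, fun t => ?_⟩⟩, Finset.mem_univ _, ?_⟩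
    · change (e (e.symm t)).1 = t.1
      rw [Equiv.apply_symm_apply]
    · ext1 u
      simp

/-- The uniform measure on simple configurations induces the uniform measure on graphs. -/
lemma card_isSimple_filter (A : BipGraph n m → Prop) [DecidablePred A] :
    (Finset.univ.filter fun e : Fin n × Fin l ≃ Fin m × Fin r =>
        IsSimple e ∧ A (graphOf e)).card =
      ((ensemble l r n m).filter A).card *
      (Fintype.card {τ : Equiv.Perm (Fin n × Fin l) // ∀ u, (τ u).1 = u.1} *
        Fintype.card {τ : Equiv.Perm (Fin m × Fin r) // ∀ u, (τ u).1 = u.1}) := by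
  rw [Finset.card_eq_sum_card_fiberwise (f := graphOf) (t := (ensemble l r n m).filter A)]
  · rw [← smul_eq_mul, ← Finset.sum_const]
    refine Finset.sum_congr rfl fun Γ hΓ => ?_
    obtain ⟨hΓ, hA⟩ := Finset.mem_filter.mp hΓ
    rw [← card_isSimple_graphOf_eq hΓ, Finset.filter_filter]
    congr 1
    ext e
    simp only [Finset.mem_filter, Finset.mem_univ, true_and]
    constructor
    · rintro ⟨⟨h1, -⟩, h2⟩
      exact ⟨h1, h2⟩
    · rintro ⟨h1, rfl⟩
      exact ⟨⟨h1, hA⟩, rfl⟩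
  · intro e he
    simp only [Finset.coe_filter, Finset.mem_univ, true_and, Set.mem_ofPred_eq] at he ⊢
    exact ⟨graphOf_mem_ensemble he.1, he.2⟩

end Graphs

/-- The indicator vector of `W` is a codeword: every check node has evenly many neighbours
in `W`. -/
def IsCodewordSupport {n m : ℕ} (Γ : BipGraph n m) (W : Finset (Fin n)) : Prop :=
  ∀ a, Even (checkNbrs Γ a ∩ W).card

open Classical in
/-- The sets of `k` check half-edges that meet every check node in evenly many half-edges. -/
noncomputable def evenSets (m r k : ℕ) : Finset (Finset (Fin m × Fin r)) :=
  (Finset.powersetCard k Finset.univ).filter fun S =>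
    ∀ a, Even (Finset.univ.filter fun j => (a, j) ∈ S).card

open Classical in
/-- Up to a polynomial factor, the probability that `W` is the support of a codeword is at most
the one in the configuration model, where the half-edges of `W` are matched to a uniform set of
check half-edges. -/
theorem card_isCodewordSupport_mul_choose_le {n m l r : ℕ} (hnm : n * l = m * r)
    (hN : 2 * (l * r) < n * l) (hr : 0 < r) (W : Finset (Fin n)) :
    ((ensemble l r n m).filter fun Γ => IsCodewordSupport Γ W).card *
        (n * l).choose (W.card * l) ≤
      2 * (n * l) ^ (8 * (l * r)) * (ensemble l r n m).card *
        (evenSets m r (W.card * l)).card := by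
  have hl : 0 < l := Nat.pos_of_ne_zero fun h => by simp [h] at hN
  have hcardU : Fintype.card (Fin n × Fin l) = n * l := by simp
  have hfib : ∀ (n l : ℕ) (u : Fin n × Fin l),
      (Finset.univ.filter fun u' : Fin n × Fin l => u'.1 = u.1).card ≤ l := by
    intro n l u
    rw [← Fintype.card_subtype, card_fst_fiber]
  set K := Fintype.card {τ : Equiv.Perm (Fin n × Fin l) // ∀ u, (τ u).1 = u.1} *
        Fintype.card {τ : Equiv.Perm (Fin m × Fin r) // ∀ u, (τ u).1 = u.1} with hK
  have hKpos : 0 < K := Nat.mul_pos (Fintype.card_pos_iff.mpr ⟨1, fun u => rfl⟩)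
    (Fintype.card_pos_iff.mpr ⟨1, fun u => rfl⟩)
  have hsimple : Fintype.card (Fin n × Fin l ≃ Fin m × Fin r) ≤
      2 * (n * l) ^ (8 * (l * r)) * ((ensemble l r n m).card * K) := by
    have h1 := card_equiv_le_mul_card_badPairs_eq_empty (U := Fin n × Fin l) (T := Fin m × Fin r)
      (v := Prod.fst) (c := Prod.fst) (Nat.mul_pos hl hr) (hfib n l) (hfib m r)
      (by rw [hcardU]; exact hN)
    have h2 := card_isSimple_filter (n := n) (m := m) (l := l) (r := r) (fun _ => True)
    simp only [and_true, Finset.filter_true] at h2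
    rw [hcardU] at h1
    rw [← hK] at h2
    rw [← h2]
    exact h1
  let P : Finset (Fin n × Fin l) := W ×ˢ Finset.univ
  have hP : P.card = W.card * l := by simp [P]
  let Q : Finset (Fin m × Fin r) → Prop := fun S =>
    ∀ a, Even (Finset.univ.filter fun j => (a, j) ∈ S).card
  have hcode : ((ensemble l r n m).filter fun Γ => IsCodewordSupport Γ W).card * K ≤
      (Finset.univ.filter fun e : Fin n × Fin l ≃ Fin m × Fin r =>
        Q (P.map e.toEmbedding)).card := by
    rw [hK, ← card_isSimple_filter (n := n) (m := m) (l := l) (r := r)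
      (fun Γ => IsCodewordSupport Γ W)]
    refine Finset.card_le_card fun e he => ?_
    simp only [Finset.mem_filter, Finset.mem_univ, true_and] at he ⊢
    intro a
    have h3 := he.2 a
    rw [card_checkNbrs_inter_graphOf he.1] at h3
    convert h3 using 4 with k
    rw [Finset.mem_map_equiv]
    simp [P]
  have hmain := card_equiv_map_mul_choose P Q
  have hT : Fintype.card (Fin m × Fin r) = n * l := by simp [hnm]
  rw [hT, hP] at hmain
  refine Nat.le_of_mul_le_mul_left ?_ hKpos
  calc K * (((ensemble l r n m).filter fun Γ => IsCodewordSupport Γ W).card *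
        (n * l).choose (W.card * l))
      = (((ensemble l r n m).filter fun Γ => IsCodewordSupport Γ W).card * K) *
        (n * l).choose (W.card * l) := by ring
    _ ≤ _ := Nat.mul_le_mul_right _ hcode
    _ = _ := hmain
    _ ≤ 2 * (n * l) ^ (8 * (l * r)) * ((ensemble l r n m).card * K) *
        (evenSets m r (W.card * l)).card := Nat.mul_le_mul hsimple (le_of_eq rfl)
    _ = _ := by ring

/-! ### Entropy bounds for binomial coefficients and for sets of given type -/

/-- The Poisson weights `a ^ j / j!` are largest at `j = a`. -/
lemma factorial_mul_pow_le (a j : ℕ) : a.factorial * a ^ j ≤ j.factorial * a ^ a := by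
  rcases le_total a j with h | h
  · calc a.factorial * a ^ j = a.factorial * a ^ (j - a) * a ^ a := by
          rw [mul_assoc, ← pow_add, Nat.sub_add_cancel h]
      _ ≤ _ := Nat.mul_le_mul_right _ (Nat.factorial_mul_pow_sub_le_factorial h)
  · have h1 := Nat.factorial_mul_descFactorial (Nat.sub_le a j)
    rw [Nat.sub_sub_self h] at h1
    calc a.factorial * a ^ j = j.factorial * a.descFactorial (a - j) * a ^ j := by rw [h1]
      _ ≤ j.factorial * a ^ (a - j) * a ^ j :=
          Nat.mul_le_mul_right _ (Nat.mul_le_mul_left _ (Nat.descFactorial_le_pow _ _))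
      _ = _ := by rw [mul_assoc, ← pow_add, Nat.sub_add_cancel h]

/-- A binomial distribution with parameter `k / N` has its mode at `k`. -/
lemma choose_mul_pow_mul_pow_le {N k j : ℕ} (hk : k ≤ N) (hj : j ≤ N) :
    N.choose j * (k ^ j * (N - k) ^ (N - j)) ≤ N.choose k * (k ^ k * (N - k) ^ (N - k)) := by
  have h1 := Nat.mul_le_mul (factorial_mul_pow_le k j) (factorial_mul_pow_le (N - k) (N - j))
  have h2 := Nat.choose_mul_factorial_mul_factorial hk
  have h3 := Nat.choose_mul_factorial_mul_factorial hj
  refine Nat.le_of_mul_le_mul_left (c := N.factorial) ?_ N.factorial_pos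
  calc N.factorial * (N.choose j * (k ^ j * (N - k) ^ (N - j)))
      = N.choose k * N.choose j *
          (k.factorial * k ^ j * ((N - k).factorial * (N - k) ^ (N - j))) := by
        rw [← h2]; ring
    _ ≤ N.choose k * N.choose j *
          (j.factorial * k ^ k * ((N - j).factorial * (N - k) ^ (N - k))) :=
        Nat.mul_le_mul_left _ h1
    _ = _ := by rw [← h3]; ring

/-- For `x = 0` the convention `log 0 = 0` forces the restriction to `k = 0`. -/
lemma pow_eq_exp_mul_log {x : ℝ} (hx : 0 ≤ x) {k : ℕ} (h : x = 0 → k = 0) :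
    x ^ k = Real.exp (k * Real.log x) := by
  rcases hx.eq_or_lt with h0 | h0
  · rw [h h0.symm]
    simp
  · rw [mul_comm, Real.exp_mul, Real.exp_log h0, Real.rpow_natCast]

lemma exp_mul_binEntropy {N k : ℕ} (hk : k ≤ N) (hN : 0 < N) :
    (k : ℝ) ^ k * ((N - k : ℕ) : ℝ) ^ (N - k) * Real.exp (N * Real.binEntropy (k / N)) =
      (N : ℝ) ^ N := by
  have hN' : (0 : ℝ) < N := by exact_mod_cast hN
  have h1 : (k : ℝ) * Real.log (k / N) = k * Real.log k - k * Real.log N := by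
    rcases Nat.eq_zero_or_pos k with rfl | h
    · simp
    · rw [Real.log_div (by positivity) (by positivity)]
      ring
  have h2 : ((N - k : ℕ) : ℝ) * Real.log ((N - k : ℕ) / N) =
      (N - k : ℕ) * Real.log (N - k : ℕ) - (N - k : ℕ) * Real.log N := by
    rcases Nat.eq_zero_or_pos (N - k) with h | h
    · rw [h]
      simp
    · rw [Real.log_div (by positivity) (by positivity)]
      ring
  have h3 : (1 : ℝ) - k / N = (N - k : ℕ) / N := by
    rw [Nat.cast_sub hk]
    field_simp
  rw [pow_eq_exp_mul_log (Nat.cast_nonneg k) (fun h => by exact_mod_cast h),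
    pow_eq_exp_mul_log (Nat.cast_nonneg (N - k)) (fun h => by exact_mod_cast h),
    pow_eq_exp_mul_log (Nat.cast_nonneg N) (fun h => by exact_mod_cast h),
    ← Real.exp_add, ← Real.exp_add, Real.binEntropy, Real.log_inv, Real.log_inv, h3]
  congr 1
  have h4 : (N : ℝ) * (k / N * -Real.log (k / N) +
      ((N - k : ℕ) : ℝ) / N * -Real.log ((N - k : ℕ) / N)) =
      -(k * Real.log (k / N)) - ((N - k : ℕ) : ℝ) * Real.log ((N - k : ℕ) / N) := by
    field_simp
    ring
  rw [h4, h1, h2, Nat.cast_sub hk]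
  ring

lemma sum_choose_mul_pow_mul_pow {N k : ℕ} (hk : k ≤ N) :
    ∑ j ∈ Finset.range (N + 1), N.choose j * (k ^ j * (N - k) ^ (N - j)) = N ^ N := by
  have h := add_pow k (N - k) N
  rw [Nat.add_sub_cancel' hk] at h
  rw [h]
  refine Finset.sum_congr rfl fun j _ => ?_
  rw [mul_comm]
  simp

lemma pow_mul_pow_self_pos {N k : ℕ} :
    (0 : ℝ) < (k : ℝ) ^ k * ((N - k : ℕ) : ℝ) ^ (N - k) := by
  have h : ∀ a : ℕ, (0 : ℝ) < (a : ℝ) ^ a := fun a => by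
    rcases Nat.eq_zero_or_pos a with rfl | h
    · simp
    · positivity
  exact mul_pos (h _) (h _)

lemma choose_le_exp_binEntropy {N k : ℕ} (hk : k ≤ N) (hN : 0 < N) :
    (N.choose k : ℝ) ≤ Real.exp (N * Real.binEntropy (k / N)) := by
  have h1 : N.choose k * (k ^ k * (N - k) ^ (N - k)) ≤ N ^ N := by
    rw [← sum_choose_mul_pow_mul_pow hk]
    exact Finset.single_le_sum (f := fun j => N.choose j * (k ^ j * (N - k) ^ (N - j)))
      (fun _ _ => Nat.zero_le _) (Finset.mem_range.mpr (by omega))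
  have h2 : (N.choose k : ℝ) * ((k : ℝ) ^ k * ((N - k : ℕ) : ℝ) ^ (N - k)) ≤ (N : ℝ) ^ N := by
    exact_mod_cast h1
  rw [← exp_mul_binEntropy hk hN, mul_comm] at h2
  exact le_of_mul_le_mul_left h2 pow_mul_pow_self_pos

lemma exp_binEntropy_le_choose {N k : ℕ} (hk : k ≤ N) (hN : 0 < N) :
    Real.exp (N * Real.binEntropy (k / N)) ≤ (N + 1) * N.choose k := by
  have h1 : N ^ N ≤ (N + 1) * (N.choose k * (k ^ k * (N - k) ^ (N - k))) := by
    rw [← sum_choose_mul_pow_mul_pow hk]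
    refine (Finset.sum_le_card_nsmul _ _ _ fun j hj =>
      choose_mul_pow_mul_pow_le hk (Nat.lt_succ_iff.mp (Finset.mem_range.mp hj))).trans ?_
    simp
  have h2 : (N : ℝ) ^ N ≤ (N + 1) *
      ((N.choose k : ℝ) * ((k : ℝ) ^ k * ((N - k : ℕ) : ℝ) ^ (N - k))) := by
    exact_mod_cast h1
  rw [← exp_mul_binEntropy hk hN] at h2
  refine le_of_mul_le_mul_left (h2.trans (le_of_eq ?_)) (pow_mul_pow_self_pos (N := N) (k := k))
  ring

/-- The exponent of the number of families of `m` even subsets of an `r`-set in which `c j` of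
the sets have size `2 j`. -/
noncomputable def typeExponent (m r : ℕ) (c : Fin (r / 2 + 1) → ℕ) : ℝ :=
  -(∑ j, (c j : ℝ) * Real.log (c j / m)) +
    ∑ j : Fin (r / 2 + 1), (c j : ℝ) * Real.log (r.choose (2 * j))

/-- The method of types: drawing `m` independent even sets of size `2 j` with probability
`c j / m` produces each family of type `c` with probability `exp (-typeExponent m r c)`. -/
lemma card_type_le {m r : ℕ} (hm : 0 < m) (c : Fin (r / 2 + 1) → ℕ) (hc : ∑ j, c j = m) :
    ((Finset.univ.filter fun g : Fin m → Finset (Fin r) =>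
      (∀ a, Even (g a).card) ∧
        ∀ j : Fin (r / 2 + 1), (Finset.univ.filter fun a => (g a).card = 2 * j).card = c j).card : ℝ)
      ≤ Real.exp (typeExponent m r c) := by
  have hm' : (0 : ℝ) < m := by exact_mod_cast hm
  have hch : ∀ j : Fin (r / 2 + 1), 0 < (r.choose (2 * j) : ℝ) := fun j => by
    have := Nat.choose_pos (n := r) (k := 2 * j) (by omega)
    exact_mod_cast this
  let p : Fin (r / 2 + 1) → ℝ := fun j => (c j / m) / r.choose (2 * j)
  have hp : ∀ j, 0 ≤ p j := fun j => div_nonneg (by positivity) (hch j).le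
  let q : Finset (Fin r) → ℝ := fun s => ∑ j : Fin (r / 2 + 1), if s.card = 2 * j then p j else 0
  have hq : ∀ s, 0 ≤ q s := fun s => Finset.sum_nonneg fun j _ => by
    split_ifs
    exacts [hp j, le_rfl]
  have hsum : ∑ s, q s = 1 := by
    simp only [q]
    rw [Finset.sum_comm]
    have h1 : ∀ j : Fin (r / 2 + 1), ∑ s : Finset (Fin r), (if s.card = 2 * j then p j else 0) =
        c j / m := by
      intro j
      rw [← Finset.sum_filter, Finset.sum_const]
      have h2 : (Finset.univ.filter fun s : Finset (Fin r) => s.card = 2 * j) =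
          Finset.powersetCard (2 * j) Finset.univ := by
        ext s
        simp [Finset.mem_powersetCard]
      rw [h2, Finset.card_powersetCard, Finset.card_univ, Fintype.card_fin, nsmul_eq_mul]
      exact mul_div_cancel₀ _ (hch j).ne'
    rw [Finset.sum_congr rfl fun j _ => h1 j, ← Finset.sum_div, ← Nat.cast_sum, hc,
      div_self hm'.ne']
  have htot : ∑ g : Fin m → Finset (Fin r), ∏ a, q (g a) = 1 := by
    rw [← Fintype.sum_pow, hsum, one_pow]
  -- all families of type `c` have the same probability
  have hval : ∀ g ∈ Finset.univ.filter fun g : Fin m → Finset (Fin r) =>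
      (∀ a, Even (g a).card) ∧
        ∀ j : Fin (r / 2 + 1), (Finset.univ.filter fun a => (g a).card = 2 * j).card = c j,
      ∏ a, q (g a) = Real.exp (-typeExponent m r c) := by
    intro g hg
    obtain ⟨heven, htype⟩ := (Finset.mem_filter.mp hg).2
    have hle : ∀ a, (g a).card / 2 < r / 2 + 1 := fun a => by
      have := Finset.card_le_univ (g a)
      rw [Fintype.card_fin] at this
      omega
    let τ : Fin m → Fin (r / 2 + 1) := fun a => ⟨(g a).card / 2, hle a⟩
    have hτ : ∀ a (j : Fin (r / 2 + 1)), (g a).card = 2 * j ↔ τ a = j := by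
      intro a j
      rw [Fin.ext_iff]
      have := Nat.two_mul_div_two_of_even (heven a)
      simp only [τ]
      omega
    have hqτ : ∀ a, q (g a) = p (τ a) := fun a => by simp [q, hτ]
    have hprod : ∏ a, q (g a) = ∏ j, p j ^ c j := by
      rw [Finset.prod_congr rfl fun a _ => hqτ a,
        ← Finset.prod_fiberwise Finset.univ τ]
      refine Finset.prod_congr rfl fun j _ => ?_
      rw [← htype j]
      simp only [hτ]
      rw [← Finset.prod_const]
      exact Finset.prod_congr rfl fun a ha => by rw [(Finset.mem_filter.mp ha).2]
    rw [hprod, typeExponent, neg_add, neg_neg, ← Finset.sum_neg_distrib, ← Finset.sum_add_distrib,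
      Real.exp_sum]
    refine Finset.prod_congr rfl fun j _ => ?_
    rw [pow_eq_exp_mul_log (hp j)]
    · rcases Nat.eq_zero_or_pos (c j) with h | h
      · simp [h]
      · have hcj : (0 : ℝ) < c j := by exact_mod_cast h
        simp only [p]
        rw [Real.log_div (by positivity) (hch j).ne']
        ring_nf
    · intro h
      simp only [p] at h
      rcases div_eq_zero_iff.mp h with h | h
      · rcases div_eq_zero_iff.mp h with h | h
        · exact_mod_cast h
        · exact absurd h hm'.ne'
      · exact absurd h (hch j).ne'
  have hle := Finset.sum_le_sum_of_subset_of_nonneg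
    (f := fun g : Fin m → Finset (Fin r) => ∏ a, q (g a))
    (Finset.filter_subset (fun g : Fin m → Finset (Fin r) =>
      (∀ a, Even (g a).card) ∧
        ∀ j : Fin (r / 2 + 1), (Finset.univ.filter fun a => (g a).card = 2 * j).card = c j)
      Finset.univ) fun g _ _ => Finset.prod_nonneg fun a _ => hq (g a)
  rw [htot, Finset.sum_congr rfl hval, Finset.sum_const, nsmul_eq_mul, Real.exp_neg,
    ← div_eq_mul_inv, div_le_one (Real.exp_pos _)] at hle
  exact hle

/-- There are only polynomially many types. -/
lemma card_evenSets_le {m r k : ℕ} (hm : 0 < m) {B : ℝ} (hB₀ : 0 ≤ B)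
    (hB : ∀ c : Fin (r / 2 + 1) → ℕ, ∑ j, c j = m → ∑ j : Fin (r / 2 + 1), 2 * (j : ℕ) * c j = k →
      Real.exp (typeExponent m r c) ≤ B) :
    ((evenSets m r k).card : ℝ) ≤ (m + 1) ^ (r / 2 + 1) * B := by
  classical
  let sec : Finset (Fin m × Fin r) → Fin m → Finset (Fin r) := fun S a =>
    Finset.univ.filter fun j => (a, j) ∈ S
  let ty : Finset (Fin m × Fin r) → Fin (r / 2 + 1) → ℕ := fun S j =>
    (Finset.univ.filter fun a => (sec S a).card = 2 * j).card
  have hmaps : ∀ S ∈ evenSets m r k,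
      ty S ∈ Fintype.piFinset fun _ : Fin (r / 2 + 1) => Finset.range (m + 1) := by
    intro S _
    rw [Fintype.mem_piFinset]
    intro j
    rw [Finset.mem_range, Nat.lt_succ_iff]
    exact (Finset.card_le_univ _).trans (by simp)
  have hsecinj : Function.Injective sec := by
    intro S S' h
    ext ⟨a, j⟩
    have := congrArg (fun g => j ∈ g a) h
    simpa [sec] using this
  have hsize : ∀ S : Finset (Fin m × Fin r), ∑ a, (sec S a).card = S.card := by
    intro S
    simp only [sec, Finset.card_filter]
    rw [← Fintype.sum_prod_type (f := fun x : Fin m × Fin r => if x ∈ S then 1 else 0)]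
    simp
  have hfib : ∀ c ∈ Fintype.piFinset fun _ : Fin (r / 2 + 1) => Finset.range (m + 1),
      (((evenSets m r k).filter fun S => ty S = c).card : ℝ) ≤ B := by
    intro c _
    rcases ((evenSets m r k).filter fun S => ty S = c).eq_empty_or_nonempty with h | ⟨S, hS⟩
    · rw [h]
      simpa using hB₀
    · simp only [evenSets, Finset.mem_filter, Finset.mem_powersetCard, Finset.subset_univ,
        true_and] at hS
      obtain ⟨⟨hcard, heven⟩, rfl⟩ := hS
      have hle : ∀ a, (sec S a).card / 2 < r / 2 + 1 := fun a => by
        have := Finset.card_le_univ (sec S a)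
        rw [Fintype.card_fin] at this
        omega
      let τ : Fin m → Fin (r / 2 + 1) := fun a => ⟨(sec S a).card / 2, hle a⟩
      have hτ : ∀ a (j : Fin (r / 2 + 1)), (sec S a).card = 2 * j ↔ τ a = j := by
        intro a j
        rw [Fin.ext_iff]
        have := Nat.two_mul_div_two_of_even (heven a)
        simp only [τ]
        change (sec S a).card = _ ↔ _
        simp only [sec] at this ⊢
        omega
      have hty : ∀ j, ty S j = (Finset.univ.filter fun a => τ a = j).card := fun j => by
        simp only [ty, hτ]
      have h1 : ∑ j, ty S j = m := by
        simp only [hty]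
        rw [← Finset.card_eq_sum_card_fiberwise (fun a _ => Finset.mem_coe.mpr (Finset.mem_univ _)),
          Finset.card_univ, Fintype.card_fin]
      have h2 : ∑ j : Fin (r / 2 + 1), 2 * (j : ℕ) * ty S j = k := by
        rw [← hcard, ← hsize, ← Finset.sum_fiberwise Finset.univ τ]
        refine Finset.sum_congr rfl fun j _ => ?_
        rw [hty, mul_comm, ← smul_eq_mul, ← Finset.sum_const]
        exact Finset.sum_congr rfl fun a ha => ((hτ a j).mpr (Finset.mem_filter.mp ha).2).symm
      refine le_trans ?_ ((card_type_le hm (ty S) h1).trans (hB (ty S) h1 h2))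
      rw [Nat.cast_le]
      refine Finset.card_le_card_of_injOn sec ?_ hsecinj.injOn
      intro S' hS'
      simp only [evenSets, Finset.coe_filter, Finset.mem_filter, Finset.mem_powersetCard,
        Finset.subset_univ, true_and, Set.mem_ofPred_eq, Finset.mem_univ] at hS' ⊢
      exact ⟨hS'.1.2, fun j => congrFun hS'.2 j⟩
  rw [Finset.card_eq_sum_card_fiberwise hmaps, Nat.cast_sum]
  refine (Finset.sum_le_card_nsmul _ _ _ hfib).trans (le_of_eq ?_)
  rw [Fintype.card_piFinset_const, Finset.card_range, nsmul_eq_mul]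
  push_cast
  rfl

/-! ### The first moment of the number of codewords inside an erasure set -/

/-- The exponents of the three counts (types, choices of the support inside the erasure set,
images of the half-edges of the support) add up to `f`. -/
lemma mul_f_eq {n m l r e w : ℕ} (hn : 0 < n) (hm : 0 < m) (he : 0 < e) (hl : 0 < l) (hr : 0 < r)
    (hnm : n * l = m * r) (c : Fin (r / 2 + 1) → ℕ) (hc : ∑ j, c j = m) :
    n * f l r (0, w / e, fun t => c t.succ / m) (e / n) =
      typeExponent m r c + e * Real.binEntropy (w / e) -
        (n * l : ℕ) * Real.binEntropy ((w * l : ℕ) / (n * l : ℕ)) := by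
  have hn' : (0 : ℝ) < n := by exact_mod_cast hn
  have hm' : (0 : ℝ) < m := by exact_mod_cast hm
  have he' : (0 : ℝ) < e := by exact_mod_cast he
  have hl' : (0 : ℝ) < l := by exact_mod_cast hl
  have hr' : (0 : ℝ) < r := by exact_mod_cast hr
  have hnm' : (n : ℝ) * l = m * r := by exact_mod_cast hnm
  have hc' : (c 0 : ℝ) + ∑ t : Fin (r / 2), (c t.succ : ℝ) = m := by
    rw [Fin.sum_univ_succ] at hc
    exact_mod_cast hc
  have h0 : (1 : ℝ) - ∑ t : Fin (r / 2), (c t.succ : ℝ) / m = c 0 / m := by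
    rw [← Finset.sum_div]
    field_simp
    linarith
  have h1 : 0 + (e : ℝ) / n * (w / e) = w / n := by
    field_simp
    ring
  have h2 : ((w * l : ℕ) : ℝ) / (n * l : ℕ) = w / n := by
    push_cast
    field_simp
  have h3 : (n : ℝ) * (l / r) = m := by
    field_simp
    linarith
  rw [h2, f, typeExponent, Fin.sum_univ_succ, Fin.sum_univ_succ]
  simp only [h0, mul_zero, h1, Real.binEntropy_zero, Fin.val_zero, Nat.choose_zero_right,
    Nat.cast_one, Real.log_one, Fin.val_succ]
  have h4 : ∑ t : Fin (r / 2), (c t.succ : ℝ) / m * Real.log (c t.succ / m) =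
      (∑ t : Fin (r / 2), (c t.succ : ℝ) * Real.log (c t.succ / m)) / m := by
    rw [Finset.sum_div]
    exact Finset.sum_congr rfl fun t _ => by ring
  have h5 : ∑ t : Fin (r / 2), (c t.succ : ℝ) / m *
        Real.log ((r.choose (2 * ((t : ℕ) + 1)) : ℕ) : ℝ) =
      (∑ t : Fin (r / 2), (c t.succ : ℝ) *
        Real.log ((r.choose (2 * ((t : ℕ) + 1)) : ℕ) : ℝ)) / m := by
    rw [Finset.sum_div]
    exact Finset.sum_congr rfl fun t _ => by ring
  rw [h4, h5]
  have h6 : (n : ℝ) * (e / n) = e := by field_simp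
  have h7 : ∀ x : ℝ, (n : ℝ) * (l / r * (x / m)) = x := fun x => by
    rw [← mul_assoc, h3]
    field_simp
  have h8 : ∀ x : ℝ, (n : ℝ) * (l / r * (c 0 / m * x)) = c 0 * x := fun x => by
    rw [← h7 (c 0 * x)]
    ring
  push_cast
  generalize ∑ t : Fin (r / 2), (c t.succ : ℝ) * Real.log (c t.succ / m) = A
  generalize ∑ t : Fin (r / 2), (c t.succ : ℝ) *
        Real.log ((r.choose (2 * ((t : ℕ) + 1)) : ℕ) : ℝ) = B
  have h7A := h7 A
  have h7B := h7 B
  have h8' := h8 (Real.log (c 0 / m))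
  linear_combination h7B - h7A - h8' + h6 * Real.binEntropy (w / e)

/-- The linear constraint of the domain counts the half-edges of the support on both sides. -/
lemma mem_domainZero_of_type {n m l r e w : ℕ} (hn : 0 < n) (hm : 0 < m) (he : 0 < e)
    (hr : 0 < r) (hwe : w ≤ e) (hnm : n * l = m * r) (c : Fin (r / 2 + 1) → ℕ)
    (hc : ∑ j, c j = m) (hc2 : ∑ j : Fin (r / 2 + 1), 2 * (j : ℕ) * c j = w * l) :
    ((0, w / e, fun t => c t.succ / m) : LoopType r) ∈ domainZero r (e / n) := by
  have hn' : (0 : ℝ) < n := by exact_mod_cast hn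
  have hm' : (0 : ℝ) < m := by exact_mod_cast hm
  have he' : (0 : ℝ) < e := by exact_mod_cast he
  have hr' : (0 : ℝ) < r := by exact_mod_cast hr
  have hwe' : (w : ℝ) ≤ e := by exact_mod_cast hwe
  have hnm' : (n : ℝ) * l = m * r := by exact_mod_cast hnm
  have hcle : ∀ j, (c j : ℝ) ≤ m := fun j => by
    rw [← hc]
    exact_mod_cast Finset.single_le_sum (f := c) (fun _ _ => Nat.zero_le _) (Finset.mem_univ j)
  have hc' : (c 0 : ℝ) + ∑ t : Fin (r / 2), (c t.succ : ℝ) = m := by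
    rw [Fin.sum_univ_succ] at hc
    exact_mod_cast hc
  have hc2' : ∑ t : Fin (r / 2), 2 * ((t : ℝ) + 1) * c t.succ = w * l := by
    rw [Fin.sum_univ_succ] at hc2
    simp only [Fin.val_zero, mul_zero, zero_mul, zero_add, Fin.val_succ] at hc2
    exact_mod_cast hc2
  refine ⟨⟨⟨le_rfl, zero_le_one⟩, ⟨by positivity, (div_le_one he').mpr hwe'⟩,
    fun t => ⟨by positivity, (div_le_one hm').mpr (hcle _)⟩, ?_, ?_⟩, rfl⟩
  · simp only
    rw [← Finset.sum_div, div_le_one hm']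
    have : (0 : ℝ) ≤ c 0 := Nat.cast_nonneg _
    linarith
  · simp only
    have h1 : ∀ t : Fin (r / 2), 2 * ((t : ℝ) + 1) / r * (c t.succ / m) =
        2 * ((t : ℝ) + 1) * c t.succ / (m * r) := fun t => by
      field_simp
    rw [Finset.sum_congr rfl fun t _ => h1 t, ← Finset.sum_div, hc2', ← hnm', mul_zero, zero_add]
    have hl' : (0 : ℝ) < l := by
      have : (0 : ℝ) < n * l := by rw [hnm']; positivity
      exact pos_of_mul_pos_right this hn'.le
    field_simp

/-- The left side divided by the binomial coefficient on the right is the expected number of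
codewords of weight `w` inside a set of size `e`, in the configuration model. -/
lemma choose_mul_card_evenSets_le {n m l r e w : ℕ} (hn : 0 < n) (hm : 0 < m) (he : 0 < e)
    (hl : 0 < l) (hr : 0 < r) (hwe : w ≤ e) (hen : e ≤ n) (hnm : n * l = m * r) {κ : ℝ}
    (hκ : ∀ y : Fin (r / 2) → ℝ, (0, (w / e : ℝ), y) ∈ domainZero r (e / n) →
      f l r (0, w / e, y) (e / n) ≤ -κ) :
    (e.choose w : ℝ) * (evenSets m r (w * l)).card ≤
      (m + 1) ^ (r / 2 + 1) * (n * l + 1) * Real.exp (-(κ * n)) *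
        (n * l).choose (w * l) := by
  have hn' : (0 : ℝ) < n := by exact_mod_cast hn
  have hwl : w * l ≤ n * l := Nat.mul_le_mul_right _ (hwe.trans hen)
  have hnl : 0 < n * l := Nat.mul_pos hn hl
  set H := ((n * l : ℕ) : ℝ) * Real.binEntropy ((w * l : ℕ) / (n * l : ℕ)) with hH
  have h1 := card_evenSets_le (r := r) (k := w * l) hm
    (B := Real.exp (H - e * Real.binEntropy (w / e) - κ * n)) (Real.exp_pos _).le
    (fun c hc hc2 => by
      rw [Real.exp_le_exp]
      have h2 := mul_f_eq (w := w) hn hm he hl hr hnm c hc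
      have h3 := hκ _ (mem_domainZero_of_type hn hm he hr hwe hnm c hc hc2)
      have h4 := mul_le_mul_of_nonneg_left h3 hn'.le
      rw [h2] at h4
      linarith)
  have h2 := choose_le_exp_binEntropy hwe he
  have h3 := exp_binEntropy_le_choose hwl hnl
  rw [← hH] at h3
  calc (e.choose w : ℝ) * (evenSets m r (w * l)).card
      ≤ Real.exp (e * Real.binEntropy (w / e)) * ((m + 1) ^ (r / 2 + 1) *
          Real.exp (H - e * Real.binEntropy (w / e) - κ * n)) := by gcongr
    _ = (m + 1) ^ (r / 2 + 1) * Real.exp (-(κ * n)) * Real.exp H := by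
        rw [mul_left_comm, ← Real.exp_add, mul_assoc, ← Real.exp_add]
        ring_nf
    _ ≤ (m + 1) ^ (r / 2 + 1) * Real.exp (-(κ * n)) *
          (((n * l : ℕ) + 1) * (n * l).choose (w * l)) := by gcongr
    _ = _ := by
        push_cast
        ring

open Classical in
/-- The expected number of codewords supported on a linear part of the erasure set `E` is
exponentially small, up to a polynomial factor, if `f` is at most `-κ` at the corresponding
points. -/
theorem sum_card_isCodewordSupport_le {n m l r : ℕ} (hnm : n * l = m * r)
    (hN : 2 * (l * r) < n * l) (hr : 0 < r) {δ κ : ℝ} (hδ : 0 < δ) (E : Finset (Fin n))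
    (hκ : ∀ p ∈ domainZero r (E.card / n), δ ≤ (E.card / n) * p.2.1 →
      f l r p (E.card / n) ≤ -κ) :
    ∑ W ∈ E.powerset.filter (fun W => δ * n ≤ W.card),
        (((ensemble l r n m).filter fun Γ => IsCodewordSupport Γ W).card : ℝ) ≤
      2 * (n * l) ^ (8 * (l * r)) * (n + 1) * ((m + 1) ^ (r / 2 + 1) * (n * l + 1)) *
        Real.exp (-(κ * n)) * (ensemble l r n m).card := by
  have hl : 0 < l := Nat.pos_of_ne_zero fun h => by simp [h] at hN
  have hn : 0 < n := Nat.pos_of_ne_zero fun h => by simp [h] at hN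
  have hm : 0 < m := Nat.pos_of_ne_zero fun h => by
    rw [h, Nat.zero_mul] at hnm
    omega
  have hn' : (0 : ℝ) < n := by exact_mod_cast hn
  have hen : E.card ≤ n := by simpa using Finset.card_le_univ E
  set e := E.card with he
  set A : ℝ := ((ensemble l r n m).card : ℝ)
  set D : ℝ := 2 * (n * l) ^ (8 * (l * r)) with hD
  let g : ℕ → ℝ := fun w => if δ * n ≤ w then
    D * A * (evenSets m r (w * l)).card / (n * l).choose (w * l) else 0
  have hchoose : ∀ w, w ≤ n → 0 < ((n * l).choose (w * l) : ℝ) := fun w hw => by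
    exact_mod_cast Nat.choose_pos (Nat.mul_le_mul_right l hw)
  have h1 : ∀ W ∈ E.powerset, (if δ * n ≤ W.card then
      (((ensemble l r n m).filter fun Γ => IsCodewordSupport Γ W).card : ℝ) else 0) ≤
        g W.card := by
    intro W hW
    simp only [g]
    split_ifs with h
    · have hWn : W.card ≤ n := by simpa using Finset.card_le_univ W
      rw [le_div_iff₀ (hchoose _ hWn)]
      have := card_isCodewordSupport_mul_choose_le hnm hN hr W
      simp only [hD, A]
      exact_mod_cast this
    · exact le_rfl
  have h2 : ∀ w ∈ Finset.range (e + 1), (e.choose w) • g w ≤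
      D * ((m + 1) ^ (r / 2 + 1) * (n * l + 1)) * Real.exp (-(κ * n)) * A := by
    intro w hw
    have hwe : w ≤ e := Nat.lt_succ_iff.mp (Finset.mem_range.mp hw)
    simp only [g]
    split_ifs with h
    · have hw0 : (0 : ℝ) < w := (mul_pos hδ hn').trans_le h
      have hw0' : 0 < w := by exact_mod_cast hw0
      have he0 : (0 : ℝ) < e := by exact_mod_cast hw0'.trans_le hwe
      have h3 := choose_mul_card_evenSets_le hn hm (hw0'.trans_le hwe) hl hr hwe hen hnm (κ := κ)
        (fun y hy => hκ _ hy (by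
          have : (e : ℝ) / n * (w / e) = w / n := by field_simp
          simp only
          rw [this, le_div_iff₀ hn']
          exact h))
      rw [nsmul_eq_mul, ← mul_div_assoc, div_le_iff₀ (hchoose _ (hwe.trans hen))]
      calc (e.choose w : ℝ) * (D * A * (evenSets m r (w * l)).card)
          = D * A * ((e.choose w : ℝ) * (evenSets m r (w * l)).card) := by ring
        _ ≤ D * A * ((m + 1) ^ (r / 2 + 1) * (n * l + 1) * Real.exp (-(κ * n)) *
            (n * l).choose (w * l)) := by gcongr
        _ = _ := by ring
    · rw [smul_zero]
      positivity
  rw [Finset.sum_filter]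
  calc _ ≤ ∑ W ∈ E.powerset, g W.card := Finset.sum_le_sum h1
    _ = ∑ w ∈ Finset.range (e + 1), (e.choose w) • g w := Finset.sum_powerset_apply_card g
    _ ≤ (e + 1 : ℕ) • (D * ((m + 1) ^ (r / 2 + 1) * (n * l + 1)) * Real.exp (-(κ * n)) * A) := by
        refine (Finset.sum_le_card_nsmul _ _ _ h2).trans (le_of_eq ?_)
        rw [Finset.card_range]
    _ ≤ (n + 1 : ℕ) • (D * ((m + 1) ^ (r / 2 + 1) * (n * l + 1)) * Real.exp (-(κ * n)) * A) :=
        nsmul_le_nsmul_left (by positivity) (by omega)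
    _ = _ := by
        rw [nsmul_eq_mul]
        push_cast
        ring

/-! ### Compactness -/

lemma continuous_f (l r : ℕ) : Continuous fun x : LoopType r × ℝ => f l r x.1 x.2 := by
  unfold f
  have h := Real.continuous_mul_log
  have h1 : Continuous fun x : LoopType r × ℝ =>
      (1 - ∑ t, x.1.2.2 t) * Real.log (1 - ∑ t, x.1.2.2 t) := h.comp (by fun_prop)
  have h2 : ∀ t, Continuous fun x : LoopType r × ℝ => x.1.2.2 t * Real.log (x.1.2.2 t) :=
    fun t => h.comp (by fun_prop)
  fun_prop

/-- If the origin is the only maximizer, then for `ρ` near `ε` the function `f` is bounded away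
from `0` on the points of the domain of linear weight. -/
theorem exists_f_le_neg {l r : ℕ} {ε : ℝ}
    (hmax : argmaxZero l r ε = {((0 : ℝ), (0 : ℝ), (0 : Fin (r / 2) → ℝ))}) {δ : ℝ} (hδ : 0 < δ) :
    ∃ κ > 0, ∀ ρ ∈ Set.Icc (0 : ℝ) 1, |ρ - ε| < κ → ∀ p ∈ domainZero r ρ, δ ≤ ρ * p.2.1 →
      f l r p ρ ≤ -κ := by
  let B : Set (LoopType r × ℝ) := {x | x.2 ∈ Set.Icc (0 : ℝ) 1 ∧ x.1 ∈ domainZero r x.2 ∧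
    δ ≤ x.2 * x.1.2.1}
  -- a point with `f ≥ 0 = f 0` would be another maximizer
  have hneg : ∀ p ∈ domainZero r ε, δ ≤ ε * p.2.1 → f l r p ε < 0 := by
    intro p hp hpδ
    by_contra! hf
    have h0 : ((0 : ℝ), (0 : ℝ), (0 : Fin (r / 2) → ℝ)) ∈ argmaxZero l r ε := by
      rw [hmax]
      rfl
    have hf0 : f l r ((0 : ℝ), (0 : ℝ), (0 : Fin (r / 2) → ℝ)) ε = 0 := by simp [f]
    have hpm : p ∈ argmaxZero l r ε :=
      ⟨hp, fun p' hp' => (h0.2 p' hp').trans (hf0.le.trans hf)⟩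
    rw [hmax, Set.mem_singleton_iff] at hpm
    rw [hpm] at hpδ
    simp only [mul_zero] at hpδ
    linarith
  have hBc : IsCompact B := by
    have hsub : B ⊆ (Set.Icc 0 1 ×ˢ (Set.Icc 0 1 ×ˢ Set.Icc 0 1)) ×ˢ Set.Icc 0 1 := by
      rintro ⟨⟨x, y, z⟩, ρ⟩ ⟨hρ, ⟨⟨hx, hy, hz, -⟩, -⟩, -⟩
      exact ⟨⟨hx, hy, fun t => (hz t).1, fun t => (hz t).2⟩, hρ⟩
    refine IsCompact.of_isClosed_subset
      ((isCompact_Icc.prod (isCompact_Icc.prod isCompact_Icc)).prod isCompact_Icc) ?_ hsub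
    have hy : IsClosed {x : LoopType r × ℝ | ∀ t, x.1.2.2 t ∈ Set.Icc (0 : ℝ) 1} := by
      simp only [Set.ofPred_forall]
      exact isClosed_iInter fun t => isClosed_Icc.preimage (by fun_prop)
    have hρ : IsClosed {x : LoopType r × ℝ | x.2 ∈ Set.Icc (0 : ℝ) 1} :=
      isClosed_Icc.preimage continuous_snd
    have hx₀ : IsClosed {x : LoopType r × ℝ | x.1.1 ∈ Set.Icc (0 : ℝ) 1} :=
      isClosed_Icc.preimage (by fun_prop)
    have hxc : IsClosed {x : LoopType r × ℝ | x.1.2.1 ∈ Set.Icc (0 : ℝ) 1} :=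
      isClosed_Icc.preimage (by fun_prop)
    have hsum : IsClosed {x : LoopType r × ℝ | ∑ t, x.1.2.2 t ≤ 1} :=
      isClosed_le (by fun_prop) continuous_const
    have hlin : IsClosed {x : LoopType r × ℝ |
        ∑ t : Fin (r / 2), (2 * ((t : ℝ) + 1) / (r : ℝ)) * x.1.2.2 t =
          (1 - x.2) * x.1.1 + x.2 * x.1.2.1} :=
      isClosed_eq (by fun_prop) (by fun_prop)
    have hzero : IsClosed {x : LoopType r × ℝ | x.1.1 = 0} :=
      isClosed_eq (by fun_prop) continuous_const
    have hδc : IsClosed {x : LoopType r × ℝ | δ ≤ x.2 * x.1.2.1} :=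
      isClosed_le continuous_const (by fun_prop)
    convert hρ.inter (((hx₀.inter (hxc.inter (hy.inter (hsum.inter hlin)))).inter hzero).inter hδc)
      using 1
    ext x
    exact Iff.rfl
  -- `max (-f) |ρ - ε|` is positive on a compact set
  let g : LoopType r × ℝ → ℝ := fun x => max (-f l r x.1 x.2) |x.2 - ε|
  have hg : Continuous g := (continuous_f l r).neg.max (by fun_prop)
  have hgpos : ∀ x ∈ B, 0 < g x := by
    rintro ⟨p, ρ⟩ ⟨hρ, hp, hpδ⟩
    simp only [g, lt_max_iff]
    by_cases h : ρ = ε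
    · subst h
      exact Or.inl (neg_pos.mpr (hneg p hp hpδ))
    · exact Or.inr (abs_pos.mpr (sub_ne_zero.mpr h))
  obtain ⟨κ, hκ, hκB⟩ := hBc.exists_forall_le' (f := g) hg.continuousOn hgpos
  refine ⟨κ, hκ, fun ρ hρ hρε p hp hpδ => ?_⟩
  rcases le_max_iff.mp (hκB (p, ρ) ⟨hρ, hp, hpδ⟩) with h | h
  · linarith
  · exact absurd h (not_le.mpr hρε)

/-! ### The erasure channel -/

section Channel

variable {n m l r : ℕ} {ε : ℝ}

/-- The positions erased in the channel output `s`. -/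
def erased (s : Fin n → SignType) : Finset (Fin n) := Finset.univ.filter fun i => s i = 0

/-- The positions at which `σ` differs from the all-one codeword. -/
def support (σ : Fin n → ℤˣ) : Finset (Fin n) := Finset.univ.filter fun i => σ i = -1

lemma becProb_nonneg (hε : ε ∈ Set.Icc (0 : ℝ) 1) (s : SignType) (σ : ℤˣ) :
    0 ≤ becProb ε s σ := by
  unfold becProb
  split_ifs
  exacts [hε.1, by linarith [hε.2], le_rfl]

lemma becProb_zero (σ : ℤˣ) : becProb ε 0 σ = ε := by simp [becProb]

lemma becProb_one_one : becProb ε 1 1 = 1 - ε := by simp [becProb]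

lemma becProb_neg_one_one : becProb ε (-1) 1 = 0 := by
  simp [becProb]

lemma sum_prod_becProb : ∑ s : Fin n → SignType, ∏ i, becProb ε (s i) 1 = 1 := by
  rw [← Fintype.sum_pow (fun x => becProb ε x 1)]
  have : (Finset.univ : Finset SignType) = {0, -1, 1} := rfl
  rw [this, Finset.sum_insert (by decide), Finset.sum_insert (by decide), Finset.sum_singleton,
    becProb_zero, becProb_one_one, becProb_neg_one_one]
  simp

/-- The erasure set has the binomial distribution. -/
lemma sum_prod_becProb_mul (G : Finset (Fin n) → ℝ) :
    ∑ s : Fin n → SignType, (∏ i, becProb ε (s i) 1) * G (erased s) =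
      ∑ E : Finset (Fin n), ε ^ E.card * (1 - ε) ^ (n - E.card) * G E := by
  rw [← Finset.sum_fiberwise Finset.univ (erased (n := n))]
  refine Finset.sum_congr rfl fun E _ => ?_
  have h1 : (Finset.univ.filter fun s : Fin n → SignType => erased s = E) =
      Fintype.piFinset fun i => if i ∈ E then {0} else {1, -1} := by
    ext s
    simp only [Finset.mem_filter, Finset.mem_univ, true_and, Fintype.mem_piFinset, erased,
      Finset.ext_iff]
    refine forall_congr' fun i => ?_
    by_cases hi : i ∈ E
    · simp [hi]
    · simp only [hi, iff_false, if_false]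
      generalize s i = x
      revert x
      decide
  calc _ = (∑ s ∈ Finset.univ.filter fun s : Fin n → SignType => erased s = E,
        ∏ i, becProb ε (s i) 1) * G E := by
        rw [Finset.sum_mul]
        exact Finset.sum_congr rfl fun s hs => by rw [(Finset.mem_filter.mp hs).2]
    _ = _ := by
        rw [h1, ← Finset.prod_univ_sum _ fun _ x => becProb ε x 1]
        congr 1
        have h2 : ∀ i : Fin n, ∑ x ∈ (if i ∈ E then {0} else {1, -1} : Finset SignType),
            becProb ε x 1 = if i ∈ E then ε else 1 - ε := by
          intro i
          split_ifs
          · rw [Finset.sum_singleton, becProb_zero]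
          · rw [Finset.sum_insert (by decide), Finset.sum_singleton, becProb_one_one,
              becProb_neg_one_one, add_zero]
        rw [Finset.prod_congr rfl fun i _ => h2 i, Finset.prod_ite, Finset.prod_const,
          Finset.prod_const, Finset.filter_not, Finset.filter_mem_eq_inter, Finset.univ_inter,
          ← Finset.compl_eq_univ_sdiff, Finset.card_compl, Fintype.card_fin]

lemma variance_card_erased :
    ∑ s : Fin n → SignType, (∏ i, becProb ε (s i) 1) * (((erased s).card : ℝ) - n * ε) ^ 2 =
      n * ε * (1 - ε) := by
  rw [sum_prod_becProb_mul fun E => ((E.card : ℝ) - n * ε) ^ 2, ← Finset.powerset_univ,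
    Finset.sum_powerset_apply_card
      (fun k => ε ^ k * (1 - ε) ^ (n - k) * ((k : ℝ) - n * ε) ^ 2)]
  have h := congrArg (Polynomial.eval ε) (bernsteinPolynomial.variance (R := ℝ) n)
  simp only [Polynomial.eval_finsetSum, bernsteinPolynomial, Polynomial.eval_mul,
    Polynomial.eval_pow, Polynomial.eval_sub, Polynomial.eval_natCast, Polynomial.eval_X,
    Polynomial.eval_one, nsmul_eq_mul] at h
  rw [← h, Finset.card_univ, Fintype.card_fin]
  refine Finset.sum_congr rfl fun k _ => ?_
  rw [nsmul_eq_mul]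
  ring

lemma prod_spin (σ : Fin n → ℤˣ) (A : Finset (Fin n)) :
    ∏ i ∈ A, spin (σ i) = (-1) ^ (A ∩ support σ).card := by
  rw [← Finset.prod_const, ← Finset.filter_mem_eq_inter, Finset.prod_filter]
  refine Finset.prod_congr rfl fun i _ => ?_
  rcases Int.units_eq_one_or (σ i) with h | h <;> simp [spin, support, h]

lemma posteriorWeight_nonneg (hε : ε ∈ Set.Icc (0 : ℝ) 1) (Γ : BipGraph n m)
    (s : Fin n → SignType) (σ : Fin n → ℤˣ) : 0 ≤ posteriorWeight ε Γ s σ := by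
  refine mul_nonneg (Finset.prod_nonneg fun a _ => ?_)
    (Finset.prod_nonneg fun i _ => becProb_nonneg hε _ _)
  rw [prod_spin]
  rcases neg_one_pow_eq_or ℝ (checkNbrs Γ a ∩ support σ).card with h | h <;> rw [h] <;> norm_num

lemma isCodewordSupport_of_posteriorWeight_ne_zero {Γ : BipGraph n m} {s : Fin n → SignType}
    {σ : Fin n → ℤˣ} (h : posteriorWeight ε Γ s σ ≠ 0) : IsCodewordSupport Γ (support σ) := by
  intro a
  by_contra hodd
  refine h (mul_eq_zero_of_left (Finset.prod_eq_zero (Finset.mem_univ a) ?_) _)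
  rw [prod_spin, (Nat.not_even_iff_odd.mp hodd).neg_one_pow]
  norm_num

lemma support_subset_erased {Γ : BipGraph n m} {s : Fin n → SignType} {σ : Fin n → ℤˣ}
    (hs : ∏ i, becProb ε (s i) 1 ≠ 0) (h : posteriorWeight ε Γ s σ ≠ 0) :
    support σ ⊆ erased s := by
  intro i hi
  have hσ : σ i = -1 := (Finset.mem_filter.mp hi).2
  have h1 := Finset.prod_ne_zero_iff.mp hs i (Finset.mem_univ i)
  have h2 := Finset.prod_ne_zero_iff.mp (right_ne_zero_of_mul h) i (Finset.mem_univ i)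
  rw [hσ] at h2
  refine Finset.mem_filter.mpr ⟨Finset.mem_univ i, ?_⟩
  generalize s i = x at h1 h2 ⊢
  cases x
  · rfl
  · exact absurd becProb_neg_one_one h1
  · exact absurd (by simp [becProb]) h2

lemma partitionFn_pos (hε : ε ∈ Set.Icc (0 : ℝ) 1) (Γ : BipGraph n m) {s : Fin n → SignType}
    (hs : ∏ i, becProb ε (s i) 1 ≠ 0) : 0 < partitionFn ε Γ s := by
  refine Finset.sum_pos' (fun σ _ => posteriorWeight_nonneg hε Γ s σ)
    ⟨fun _ => 1, Finset.mem_univ _, ?_⟩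
  refine lt_of_le_of_ne (posteriorWeight_nonneg hε Γ s _) (Ne.symm ?_)
  simpa [posteriorWeight, spin] using hs

lemma sum_posterior (hε : ε ∈ Set.Icc (0 : ℝ) 1) (Γ : BipGraph n m) {s : Fin n → SignType}
    (hs : ∏ i, becProb ε (s i) 1 ≠ 0) : ∑ σ, posterior ε Γ s σ = 1 := by
  simp only [posterior]
  rw [← Finset.sum_div]
  exact div_self (partitionFn_pos hε Γ hs).ne'

/-- The fraction of wrong bits is the average relative weight of a posterior sample. -/
lemma half_one_sub_mean (hε : ε ∈ Set.Icc (0 : ℝ) 1) (hn : 0 < n) (Γ : BipGraph n m)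
    {s : Fin n → SignType} (hs : ∏ i, becProb ε (s i) 1 ≠ 0) :
    (1 / 2 : ℝ) * (1 - (1 / (n : ℝ)) * ∑ i : Fin n, posteriorMean ε Γ s i) =
      ∑ σ, posterior ε Γ s σ * ((support σ).card / n) := by
  have hn' : (0 : ℝ) < n := by exact_mod_cast hn
  have h1 : ∀ σ : Fin n → ℤˣ, ∑ i, spin (σ i) = n - 2 * (support σ).card := by
    intro σ
    have h2 : ∀ i, spin (σ i) = 1 - 2 * if σ i = -1 then (1 : ℝ) else 0 := by
      intro i
      rcases Int.units_eq_one_or (σ i) with h | h <;> rw [h] <;> norm_num [spin]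
    simp only [h2, Finset.sum_sub_distrib, ← Finset.mul_sum, Finset.sum_boole, support]
    simp
  have h3 : ∑ i : Fin n, posteriorMean ε Γ s i =
      ∑ σ, posterior ε Γ s σ * (n - 2 * (support σ).card) := by
    simp only [posteriorMean]
    rw [Finset.sum_comm]
    exact Finset.sum_congr rfl fun σ _ => by rw [← Finset.mul_sum, h1]
  have h4 : ∑ σ, posterior ε Γ s σ * ((n : ℝ) - 2 * (support σ).card) =
      n * (∑ σ, posterior ε Γ s σ) - 2 * n * ∑ σ, posterior ε Γ s σ * ((support σ).card / n) := by
    rw [Finset.mul_sum, Finset.mul_sum, ← Finset.sum_sub_distrib]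
    refine Finset.sum_congr rfl fun σ _ => ?_
    field_simp
  rw [h3, h4, sum_posterior hε Γ hs]
  field_simp
  ring

/-- The conditional error probability of the bit-sampling decoder given the output `s`. -/
noncomputable def outputError (ε : ℝ) (Γ : BipGraph n m) (s : Fin n → SignType) : ℝ :=
  (1 / 2 : ℝ) * (1 - (1 / (n : ℝ)) * ∑ i : Fin n, posteriorMean ε Γ s i)

lemma bitSamplingError_eq (Γ : BipGraph n m) :
    bitSamplingError ε Γ = ∑ s : Fin n → SignType, (∏ i, becProb ε (s i) 1) * outputError ε Γ s := by
  have h : ∀ s : Fin n → SignType, (∏ i, becProb ε (s i) 1) * outputError ε Γ s =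
      1 / 2 * (∏ i, becProb ε (s i) 1) - 1 / 2 * ((∏ i, becProb ε (s i) 1) *
        ((1 / (n : ℝ)) * ∑ i : Fin n, posteriorMean ε Γ s i)) := fun s => by
    rw [outputError]
    ring
  rw [Finset.sum_congr rfl fun s _ => h s, Finset.sum_sub_distrib, ← Finset.mul_sum,
    ← Finset.mul_sum, sum_prod_becProb, bitSamplingError, channelExpect]
  ring

lemma posterior_nonneg (hε : ε ∈ Set.Icc (0 : ℝ) 1) (Γ : BipGraph n m) (s : Fin n → SignType)
    (σ : Fin n → ℤˣ) : 0 ≤ posterior ε Γ s σ :=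
  div_nonneg (posteriorWeight_nonneg hε Γ s σ)
    (Finset.sum_nonneg fun σ _ => posteriorWeight_nonneg hε Γ s σ)

lemma outputError_nonneg (hε : ε ∈ Set.Icc (0 : ℝ) 1) (hn : 0 < n) (Γ : BipGraph n m)
    {s : Fin n → SignType} (hs : ∏ i, becProb ε (s i) 1 ≠ 0) : 0 ≤ outputError ε Γ s := by
  rw [outputError, half_one_sub_mean hε hn Γ hs]
  exact Finset.sum_nonneg fun σ _ => mul_nonneg (posterior_nonneg hε Γ s σ) (by positivity)

lemma outputError_le_of_forall (hε : ε ∈ Set.Icc (0 : ℝ) 1) (hn : 0 < n) (Γ : BipGraph n m)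
    {s : Fin n → SignType} (hs : ∏ i, becProb ε (s i) 1 ≠ 0) {M : ℝ}
    (hM : ∀ σ, posteriorWeight ε Γ s σ ≠ 0 → ((support σ).card / n : ℝ) ≤ M) :
    outputError ε Γ s ≤ M := by
  rw [outputError, half_one_sub_mean hε hn Γ hs, ← one_mul M, ← sum_posterior hε Γ hs,
    Finset.sum_mul]
  refine Finset.sum_le_sum fun σ _ => ?_
  by_cases h : posteriorWeight ε Γ s σ = 0
  · simp [posterior, h]
  · exact mul_le_mul_of_nonneg_left (hM σ h) (posterior_nonneg hε Γ s σ)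

lemma card_div_le_one (W : Finset (Fin n)) : (W.card / n : ℝ) ≤ 1 := by
  refine div_le_one_of_le₀ ?_ (Nat.cast_nonneg n)
  have := Finset.card_le_univ W
  rw [Fintype.card_fin] at this
  exact_mod_cast this

lemma outputError_le_one (hε : ε ∈ Set.Icc (0 : ℝ) 1) (hn : 0 < n) (Γ : BipGraph n m)
    {s : Fin n → SignType} (hs : ∏ i, becProb ε (s i) 1 ≠ 0) : outputError ε Γ s ≤ 1 :=
  outputError_le_of_forall hε hn Γ hs fun _ _ => card_div_le_one _

open Classical in
/-- Unless there is a codeword of weight at least `δ n` on the erased positions, a posterior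
sample has fewer than `δ n` wrong bits. -/
lemma outputError_le (hε : ε ∈ Set.Icc (0 : ℝ) 1) (hn : 0 < n) (Γ : BipGraph n m)
    {s : Fin n → SignType} (hs : ∏ i, becProb ε (s i) 1 ≠ 0) {δ : ℝ} (hδ : 0 ≤ δ) :
    outputError ε Γ s ≤ δ + ∑ W ∈ (erased s).powerset.filter (fun W => δ * n ≤ W.card),
      if IsCodewordSupport Γ W then (1 : ℝ) else 0 := by
  have hn' : (0 : ℝ) < n := by exact_mod_cast hn
  refine outputError_le_of_forall hε hn Γ hs fun σ hσ => ?_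
  have hnonneg : ∀ W ∈ (erased s).powerset.filter (fun W => δ * n ≤ W.card),
      (0 : ℝ) ≤ if IsCodewordSupport Γ W then (1 : ℝ) else 0 := fun W _ => by
    split_ifs <;> norm_num
  by_cases h : δ * n ≤ (support σ).card
  · have h1 := Finset.single_le_sum hnonneg (Finset.mem_filter.mpr
      ⟨Finset.mem_powerset.mpr (support_subset_erased hs hσ), h⟩)
    rw [if_pos (isCodewordSupport_of_posteriorWeight_ne_zero hσ)] at h1
    linarith [card_div_le_one (support σ)]
  · have h1 := Finset.sum_nonneg hnonneg
    have h2 : ((support σ).card / n : ℝ) ≤ δ := by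
      rw [div_le_iff₀ hn']
      linarith
    linarith

lemma expectedBitSamplingError_nonneg (hε : ε ∈ Set.Icc (0 : ℝ) 1) (hn : 0 < n) :
    0 ≤ expectedBitSamplingError l r ε n m := by
  refine div_nonneg (Finset.sum_nonneg fun Γ _ => ?_) (Nat.cast_nonneg _)
  rw [bitSamplingError_eq]
  refine Finset.sum_nonneg fun s _ => ?_
  by_cases hs : ∏ i, becProb ε (s i) 1 = 0
  · rw [hs, zero_mul]
  · exact mul_nonneg (Finset.prod_nonneg fun i _ => becProb_nonneg hε _ _)
      (outputError_nonneg hε hn Γ hs)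

/-- The error is at most `δ`, plus the expected number of codewords of weight at least `δ n` on a
typical erasure set, plus the probability of an atypical erasure set (by Chebyshev's
inequality). -/
theorem expectedBitSamplingError_le (hε : ε ∈ Set.Icc (0 : ℝ) 1) (hnm : n * l = m * r)
    (hN : 2 * (l * r) < n * l) (hr : 0 < r) {δ κ : ℝ} (hδ : 0 < δ) (hκ : 0 < κ)
    (hf : ∀ ρ ∈ Set.Icc (0 : ℝ) 1, |ρ - ε| < κ → ∀ p ∈ domainZero r ρ, δ ≤ ρ * p.2.1 →
      f l r p ρ ≤ -κ) :
    expectedBitSamplingError l r ε n m ≤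
      δ + 2 * (n * l) ^ (8 * (l * r)) * (n + 1) * ((m + 1) ^ (r / 2 + 1) * (n * l + 1)) *
        Real.exp (-(κ * n)) + 1 / (κ ^ 2 * n) := by
  classical
  have hn : 0 < n := Nat.pos_of_ne_zero fun h => by simp [h] at hN
  have hn' : (0 : ℝ) < n := by exact_mod_cast hn
  set Q : ℝ := 2 * (n * l) ^ (8 * (l * r)) * (n + 1) * ((m + 1) ^ (r / 2 + 1) * (n * l + 1)) *
        Real.exp (-(κ * n)) with hQ
  have hQ0 : 0 ≤ Q := by positivity
  set A : ℝ := ((ensemble l r n m).card : ℝ) with hA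
  have hA0 : 0 ≤ A := Nat.cast_nonneg _
  have key : ∀ s : Fin n → SignType, ∏ i, becProb ε (s i) 1 ≠ 0 →
      ∑ Γ ∈ ensemble l r n m, outputError ε Γ s ≤
        A * (δ + Q + (((erased s).card : ℝ) - n * ε) ^ 2 / (κ * n) ^ 2) := by
    intro s hs
    -- an atypical erasure set is charged to the last term, which then is at least `1`
    by_cases htyp : |((erased s).card / n : ℝ) - ε| < κ
    · have h1 := sum_card_isCodewordSupport_le hnm hN hr hδ (erased s)
        (hf _ ⟨by positivity, card_div_le_one _⟩ htyp)
      have h2 : ∑ Γ ∈ ensemble l r n m, outputError ε Γ s ≤ A * δ + Q * A := by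
        refine (Finset.sum_le_sum fun Γ _ => outputError_le hε hn Γ hs hδ.le).trans ?_
        rw [Finset.sum_add_distrib, Finset.sum_const, nsmul_eq_mul, Finset.sum_comm]
        refine add_le_add le_rfl (le_trans (le_of_eq ?_) h1)
        refine Finset.sum_congr rfl fun W _ => ?_
        rw [Finset.sum_boole]
      have h3 : 0 ≤ A * ((((erased s).card : ℝ) - n * ε) ^ 2 / (κ * n) ^ 2) := by positivity
      linarith
    · have h1 : (1 : ℝ) ≤ (((erased s).card : ℝ) - n * ε) ^ 2 / (κ * n) ^ 2 := by
        rw [one_le_div (by positivity), sq_le_sq, abs_of_pos (by positivity)]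
        have h2 : ((erased s).card : ℝ) - n * ε = n * ((erased s).card / n - ε) := by field_simp
        rw [h2, abs_mul, abs_of_pos hn', mul_comm]
        exact mul_le_mul_of_nonneg_left (not_lt.mp htyp) hn'.le
      calc _ ≤ ∑ Γ ∈ ensemble l r n m, (1 : ℝ) :=
            Finset.sum_le_sum fun Γ _ => outputError_le_one hε hn Γ hs
        _ = A * 1 := by simp [hA]
        _ ≤ _ := mul_le_mul_of_nonneg_left (by linarith) hA0
  have hbound : ∑ Γ ∈ ensemble l r n m, bitSamplingError ε Γ ≤ A * (δ + Q + 1 / (κ ^ 2 * n)) := by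
    simp only [bitSamplingError_eq]
    rw [Finset.sum_comm]
    calc _ ≤ ∑ s : Fin n → SignType, (∏ i, becProb ε (s i) 1) *
          (A * (δ + Q + (((erased s).card : ℝ) - n * ε) ^ 2 / (κ * n) ^ 2)) := by
          refine Finset.sum_le_sum fun s _ => ?_
          rw [← Finset.mul_sum]
          by_cases hs : ∏ i, becProb ε (s i) 1 = 0
          · rw [hs, zero_mul, zero_mul]
          · exact mul_le_mul_of_nonneg_left (key s hs)
              (Finset.prod_nonneg fun i _ => becProb_nonneg hε _ _)
      _ = A * (δ + Q) * ∑ s : Fin n → SignType, (∏ i, becProb ε (s i) 1) +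
          A / (κ * n) ^ 2 * ∑ s : Fin n → SignType, (∏ i, becProb ε (s i) 1) *
            (((erased s).card : ℝ) - n * ε) ^ 2 := by
          rw [Finset.mul_sum, Finset.mul_sum, ← Finset.sum_add_distrib]
          exact Finset.sum_congr rfl fun s _ => by ring
      _ = A * (δ + Q + ε * (1 - ε) / (κ ^ 2 * n)) := by
          rw [sum_prod_becProb, variance_card_erased]
          field_simp
      _ ≤ _ := by
          have : ε * (1 - ε) ≤ 1 := by nlinarith [hε.1, hε.2]
          gcongr
  refine div_le_of_le_mul₀ hA0 (by positivity) ?_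
  linarith

end Channel

end LDPC

/-- The limit is taken over the block lengths `n` for which `(l, r)` regular graphs can exist, that
is those with `r ∣ n * l`; the number of check nodes is then `m = n * l / r`. -/
theorem theorem1 (l r : ℕ) (hl : 3 ≤ l) (hr : l < r) (ε : ℝ) (hε : ε ∈ Set.Icc (0 : ℝ) 1)
    (hmax : LDPC.argmaxZero l r ε = {((0 : ℝ), (0 : ℝ), (0 : Fin (r / 2) → ℝ))}) :
    Tendsto (fun n : ℕ => LDPC.expectedBitSamplingError l r ε n (n * l / r))
      (atTop ⊓ 𝓟 {n : ℕ | r ∣ n * l}) (𝓝 0) := by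
  rw [Metric.tendsto_nhds]
  intro η hη
  rw [eventually_inf_principal]
  obtain ⟨κ, hκ, hf⟩ := LDPC.exists_f_le_neg hmax (δ := η / 2) (by positivity)
  -- the degree of the polynomial prefactor of `exp (-κ n)`
  set D := 8 * (l * r) + 1 + (r / 2 + 1) + 1 with hD
  have hexp : |Real.exp (-κ)| < 1 := by
    rw [abs_of_pos (Real.exp_pos _), Real.exp_lt_one_iff]
    linarith
  have hlim : Tendsto (fun n : ℕ => 2 * (l + 1 : ℝ) ^ D * ((n : ℝ) ^ D * Real.exp (-κ) ^ n) +
      1 / κ ^ 2 * (1 / (n : ℝ))) atTop (𝓝 0) := by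
    have h1 := ((tendsto_pow_const_mul_const_pow_of_abs_lt_one D hexp).const_mul
      (2 * (l + 1 : ℝ) ^ D)).add (tendsto_one_div_atTop_nhds_zero_nat.const_mul (1 / κ ^ 2))
    rwa [mul_zero, mul_zero, add_zero] at h1
  filter_upwards [hlim.eventually_lt_const (half_pos hη), eventually_gt_atTop (2 * r)]
    with n hn hnr hdvd
  have hdvd : r ∣ n * l := hdvd
  have hn0 : 0 < n := by omega
  have hn0' : (1 : ℝ) ≤ n := by exact_mod_cast hn0
  have hnm : n * l = n * l / r * r := (Nat.div_mul_cancel hdvd).symm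
  have hN : 2 * (l * r) < n * l := by nlinarith
  have hm : n * l / r ≤ n * l := Nat.div_le_self _ _
  have hle := LDPC.expectedBitSamplingError_le hε hnm hN (by omega) (half_pos hη) hκ hf
  have h0 := LDPC.expectedBitSamplingError_nonneg (l := l) (r := r) (m := n * l / r) hε hn0
  rw [Real.dist_eq, sub_zero, abs_of_nonneg h0]
  generalize n * l / r = m at hm hle
  have hm' : (m : ℝ) ≤ n * l := by exact_mod_cast hm
  have hl' : (1 : ℝ) ≤ l := by exact_mod_cast (by omega : 1 ≤ l)
  have hpoly : 2 * ((n : ℝ) * l) ^ (8 * (l * r)) * (n + 1) *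
      ((m + 1) ^ (r / 2 + 1) * (n * l + 1)) ≤ 2 * (l + 1 : ℝ) ^ D * (n : ℝ) ^ D := by
    have h1 : (n : ℝ) * l ≤ (l + 1) * n := by nlinarith
    have h2 : (n : ℝ) + 1 ≤ (l + 1) * n := by nlinarith
    have h3 : (m : ℝ) + 1 ≤ (l + 1) * n := by nlinarith
    have h4 : (n : ℝ) * l + 1 ≤ (l + 1) * n := by nlinarith
    calc _ ≤ 2 * ((l + 1) * (n : ℝ)) ^ (8 * (l * r)) * ((l + 1) * n) *
          (((l + 1) * n) ^ (r / 2 + 1) * ((l + 1) * n)) := by gcongr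
      _ = 2 * ((l + 1) * (n : ℝ)) ^ D := by
          rw [hD, pow_succ, pow_add, pow_succ]
          ring
      _ = _ := by rw [mul_pow, mul_assoc]
  have hexpn : Real.exp (-(κ * n)) = Real.exp (-κ) ^ n := by
    rw [← Real.exp_nat_mul]
    ring_nf
  have h5 := mul_le_mul_of_nonneg_right hpoly (Real.exp_pos (-(κ * n))).le
  rw [hexpn] at h5 hle
  have h6 : 1 / (κ ^ 2 * (n : ℝ)) = 1 / κ ^ 2 * (1 / (n : ℝ)) := by
    field_simp
  rw [h6] at hle
  rw [mul_assoc (2 * (l + 1 : ℝ) ^ D)] at h5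
  linarith
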